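/- Let $\omega\in\mathbb R$ and let $Q_1\in H^{1/2}(\mathbb R)$ be a complex-valued solution, in the sense of tempered distributions, of $$\sqrt{-\Delta}\,Q_1+i\,\partial_xQ_1+\omega Q_1-|Q_1|^3Q_1=0\quad\text{on }\mathbb R,$$ where $\sqrt{-\Delta}$ is the Fourier multiplier $\widehat{\sqrt{-\Delta}f}(\xi)=|\xi|\hat f(\xi)$ (with $\hat f(\xi)=\int_{\mathbb R}e^{-ix\xi}f(x)\,dx$). Then there is a constant $C$ (depending on $Q_1$) such that $$|Q_1(x)|\le\frac{C}{1+|x|^2}\qquad\text{for almost every }x\in\mathbb R .$$ -/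

import Mathlib

open MeasureTheory FourierTransform TemperedDistribution
open scoped SchwartzMap

noncomputable section

/-- The tempered distribution `√(-Δ) f` of an `f ∈ L²(ℝ)`, evaluated at a Schwartz function `φ`.
It is defined by `𝓕 (√(-Δ) f) = |2πξ| 𝓕 f`, where `𝓕 f (ξ) = ∫ exp (-2πixξ) f(x) dx`; that is,
`⟨√(-Δ) f, φ⟩ = ⟨|2πξ| 𝓕 f, 𝓕⁻ φ⟩`. The integrand is integrable for every `f ∈ L²(ℝ)`. -/
def sqrtNegLaplacian (f : Lp ℂ 2 (volume : Measure ℝ)) (φ : 𝓢(ℝ, ℂ)) : ℂ :=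
  ∫ ξ : ℝ, ((|2 * Real.pi * ξ| : ℝ) : ℂ) * (𝓕 f : Lp ℂ 2 (volume : Measure ℝ)) ξ * (𝓕⁻ φ) ξ

/-- `Q ∈ H^{1/2}(ℝ)`. -/
def MemHHalf (Q : Lp ℂ 2 (volume : Measure ℝ)) : Prop :=
  MemSobolev (1 / 2) 2 (Q : 𝓢'(ℝ, ℂ))

/-- `√(-Δ) Q + i ∂ₓ Q + ω Q - |Q|³ Q = 0` in the sense of tempered distributions. -/
def SolvesProfileEquation (ω : ℝ) (Q : Lp ℂ 2 (volume : Measure ℝ)) : Prop :=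
  ∀ φ : 𝓢(ℝ, ℂ),
    sqrtNegLaplacian Q φ + Complex.I * derivCLM ℂ (Q : 𝓢'(ℝ, ℂ)) φ
      + (ω : ℂ) * (Q : 𝓢'(ℝ, ℂ)) φ - ∫ x : ℝ, φ x * (((‖Q x‖ ^ 3 : ℝ) : ℂ) * Q x) = 0

end

open Filter Topology
open scoped ComplexConjugate

/-! The decay bound holds because every solution vanishes almost everywhere, so the constant `0`
serves. Put `G = (|Q|³ - ω) Q`. On the Fourier side the equation reads `𝓕 G = symb * 𝓕 Q`, where
`symb` is `0` on the positive frequencies and `4π|l|` on the negative ones (`fourier_eq_symb_mul`).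
For this to be an identity in `L²` one needs `Q ∈ L⁸`, which is `memLp_eight`.

If `ω = -c ≤ 0`, the energy density `B = |Q|⁵/5 + c|Q|²/2` is a convex function of `Q` with gradient
`G`. Formally, `B' = Re (conj Q' * G)`. Since `symb` is linear on each half-line, the Fourier
coefficient of the right side at a small frequency `k` comes only from a window of length `k` around
the origin and is `O(k²)`, while that of `B'` is of size `k ∫ B`. Hence `∫ B ≤ 0` and `Q = 0`. As
`Q` has too little regularity for the chain rule, difference quotients are used, and convexity
supplies the needed one-sided inequality (`re_conj_sub_mul_le`, `norm_add_conj_le`,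
`re_integral_energy_mul_char_le`).

If `ω > 0`, consider the real density `conj G * Q = (|Q|³ - ω)|Q|²`. Its Fourier transform is
integrable by a Hardy inequality (`lintegral_Ioi_lintegral_symb_lt_top`), so the density tends to
`0` at infinity. Thus near infinity `|Q|` avoids an interval of values between `0` and `ω^(1/3)`. A
function of class `H^{1/2}` cannot jump across such a gap (`norm_le_of_gap`), and `Q ∈ L²` forces
the lower branch, where the density is nonpositive. Testing it against `1 - cos (2πkx)` gives a
lower bound of order `k` times the mass of `𝓕 Q` below `-k`, and an upper bound `O(k²)`, since only
a bounded region contributes positively. As `k → 0` the negative frequencies of `Q` disappear, so `G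
= 0`. Then `|Q|` takes only the values `0` and `ω^(1/3)`, and the gap argument applied once more
gives `Q = 0`. -/

/-- The space `L²(ℝ)` of complex-valued functions. -/
abbrev L2R : Type := Lp ℂ 2 (volume : Measure ℝ)

/-- The character `t ↦ exp (2πit)`. -/
noncomputable def char (t : ℝ) : ℂ := Complex.exp (((2 * Real.pi * t : ℝ) : ℂ) * Complex.I)

theorem norm_char (t : ℝ) : ‖char t‖ = 1 := Complex.norm_exp_ofReal_mul_I _

theorem char_zero : char 0 = 1 := by simp [char]

theorem char_add (s t : ℝ) : char (s + t) = char s * char t := by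
  rw [char, char, char, ← Complex.exp_add]; push_cast; ring_nf

theorem conj_char (t : ℝ) : conj (char t) = char (-t) := by
  rw [char, char, ← Complex.exp_conj, map_mul, Complex.conj_ofReal, Complex.conj_I]
  push_cast; ring_nf

theorem continuous_char : Continuous char := by unfold char; fun_prop

theorem coe_fourierChar (t : ℝ) : (𝐞 t : ℂ) = char t := by
  rw [char, Real.fourierChar_apply]

/-! ### The Fourier transform on `L²(ℝ)` -/

theorem integral_fourier_mul_L2 (f : L2R) (φ : 𝓢(ℝ, ℂ)) :
    ∫ x, (𝓕 φ) x * f x = ∫ ξ, φ ξ * (𝓕 f : L2R) ξ := by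
  have h := congrArg (fun T : 𝓢'(ℝ, ℂ) => T φ) (Lp.fourier_toTemperedDistribution_eq f)
  simpa using h

theorem integral_fourierInv_mul_L2 (f : L2R) (φ : 𝓢(ℝ, ℂ)) :
    ∫ x, (𝓕⁻ φ) x * f x = ∫ ξ, φ ξ * (𝓕⁻ f : L2R) ξ := by
  have h := congrArg (fun T : 𝓢'(ℝ, ℂ) => T φ) (Lp.fourierInv_toTemperedDistribution_eq f)
  simpa using h

/-- The Fourier transform on `L²` has no pointwise formula. Its identities are checked against
Schwartz functions, and this lemma turns them into almost everywhere equalities. -/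
theorem ae_eq_of_integral_schwartz_mul_eq {u v : ℝ → ℂ} (hu : LocallyIntegrable u)
    (hv : LocallyIntegrable v) (h : ∀ φ : 𝓢(ℝ, ℂ), ∫ x, φ x * u x = ∫ x, φ x * v x) :
    u =ᵐ[volume] v := by
  refine ae_eq_of_integral_contDiff_smul_eq hu hv fun g hg hgc => ?_
  have hg₁ : HasCompactSupport (Complex.ofRealCLM ∘ g) := hgc.comp_left rfl
  have hg₂ : ContDiff ℝ (⊤ : ℕ∞) (Complex.ofRealCLM ∘ g) := by fun_prop
  simpa using h (hg₁.toSchwartzMap hg₂)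

theorem locallyIntegrable_L2 (f : L2R) : LocallyIntegrable (f : ℝ → ℂ) :=
  (Lp.memLp f).locallyIntegrable (by norm_num)

theorem memLp_two_char_mul {f : ℝ → ℂ} (hf : MemLp f 2) (k : ℝ) :
    MemLp (fun x => char (k * x) * f x) 2 := by
  refine hf.of_le ?_ (ae_of_all _ fun x => by simp [norm_char])
  refine AEStronglyMeasurable.mul ?_ hf.1
  exact (continuous_char.comp (continuous_const.mul continuous_id)).aestronglyMeasurable

theorem fourier_comp_add_right (φ : ℝ → ℂ) (k x : ℝ) :
    𝓕 (fun v => φ (v + k)) x = char (k * x) * 𝓕 φ x := by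
  have h := congrFun (VectorFourier.fourierIntegral_comp_add_right 𝐞 volume (innerₗ ℝ) φ k) x
  rw [Circle.smul_def, coe_fourierChar, smul_eq_mul] at h
  convert! h using 3
  simp [mul_comm]

theorem fourierInv_comp_add_right (φ : ℝ → ℂ) (k x : ℝ) :
    𝓕⁻ (fun v => φ (v + k)) x = char (-(k * x)) * 𝓕⁻ φ x := by
  rw [Real.fourierInv_eq_fourier_neg, Real.fourierInv_eq_fourier_neg, fourier_comp_add_right,
    mul_neg]

theorem fourier_char_mul_L2 {f g : L2R} {k : ℝ}
    (hg : g =ᵐ[volume] fun x => char (k * x) * f x) :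
    (𝓕 g : L2R) =ᵐ[volume] fun l => (𝓕 f : L2R) (l - k) := by
  have hmem : MemLp (fun l => (𝓕 f : L2R) (l - k)) 2 :=
    (Lp.memLp (𝓕 f : L2R)).comp_measurePreserving (measurePreserving_sub_right volume k)
  refine ae_eq_of_integral_schwartz_mul_eq (locallyIntegrable_L2 _)
    (hmem.locallyIntegrable (by norm_num)) fun φ => ?_
  have h1 : ∀ x, 𝓕 (φ.compSubConstCLM ℂ (-k)) x = char (k * x) * 𝓕 φ x := by
    intro x
    rw [SchwartzMap.fourier_coe, SchwartzMap.fourier_coe, ← fourier_comp_add_right]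
    refine congrFun (congrArg _ (funext fun v => ?_)) x
    simp
  rw [← integral_fourier_mul_L2 g φ]
  calc ∫ x, 𝓕 φ x * g x = ∫ x, 𝓕 (φ.compSubConstCLM ℂ (-k)) x * f x := by
        refine integral_congr_ae ?_
        filter_upwards [hg] with x hx
        rw [hx, h1]; ring
    _ = ∫ l, φ (l - -k) * (𝓕 f : L2R) l := by
        rw [integral_fourier_mul_L2]; rfl
    _ = ∫ l, φ l * (𝓕 f : L2R) (l - k) := by
        rw [← integral_add_right_eq_self _ (-k)]
        simp [sub_eq_add_neg]

theorem fourier_comp_add_right_L2 {f g : L2R} {s : ℝ}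
    (hg : g =ᵐ[volume] fun x => f (x + s)) :
    (𝓕 g : L2R) =ᵐ[volume] fun l => char (s * l) * (𝓕 f : L2R) l := by
  refine ae_eq_of_integral_schwartz_mul_eq (locallyIntegrable_L2 _)
    ((memLp_two_char_mul (Lp.memLp _) s).locallyIntegrable (by norm_num)) fun φ => ?_
  set ψ : 𝓢(ℝ, ℂ) := 𝓕⁻ ((𝓕 φ).compSubConstCLM ℂ s) with hψ
  have h1 : ∀ x, ψ x = char (s * x) * φ x := by
    intro x
    have h2 : φ x = 𝓕⁻ (𝓕 φ) x := by simp
    rw [h2, hψ, SchwartzMap.fourierInv_coe, SchwartzMap.fourierInv_coe]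
    have := fourierInv_comp_add_right (𝓕 φ : 𝓢(ℝ, ℂ)) (-s) x
    rw [neg_mul, neg_neg] at this
    rw [← this]
    rfl
  rw [← integral_fourier_mul_L2 g φ]
  calc ∫ x, 𝓕 φ x * g x = ∫ x, 𝓕 φ x * f (x + s) := by
        refine integral_congr_ae ?_
        filter_upwards [hg] with x hx
        rw [hx]
    _ = ∫ x, 𝓕 φ (x - s) * f x := by
        rw [← integral_add_right_eq_self _ (-s)]
        simp [sub_eq_add_neg]
    _ = ∫ x, 𝓕 ψ x * f x := by
        simp [hψ]
    _ = ∫ l, ψ l * (𝓕 f : L2R) l := integral_fourier_mul_L2 f ψ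
    _ = _ := by
        refine integral_congr_ae (ae_of_all _ fun x => ?_)
        simp only [h1]; ring

theorem integral_conj_mul_fourier (f g : L2R) :
    ∫ x, conj (f x) * g x = ∫ l, conj ((𝓕 f : L2R) l) * (𝓕 g : L2R) l := by
  have h := Lp.inner_fourier_eq f g
  rw [L2.inner_def, L2.inner_def] at h
  simpa [mul_comm] using h.symm

/-- The Fourier transform of a product of two `L²` functions is a convolution. -/
theorem integral_conj_mul_char_fourier (f g : L2R) (k : ℝ) :
    ∫ x, conj (f x) * g x * char (k * x) =
      ∫ l, conj ((𝓕 f : L2R) (l + k)) * (𝓕 g : L2R) l := by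
  set f' : L2R := (memLp_two_char_mul (Lp.memLp f) (-k)).toLp _ with hf'
  have h1 := (memLp_two_char_mul (Lp.memLp f) (-k)).coeFn_toLp
  have h2 := fourier_char_mul_L2 h1
  calc _ = ∫ x, conj (f' x) * g x := by
        refine integral_congr_ae ?_
        filter_upwards [h1] with x hx
        rw [hf', hx]
        have : conj (char (-k * x)) = char (k * x) := by
          rw [conj_char, neg_mul, neg_neg]
        rw [map_mul, this]; ring
    _ = ∫ l, conj ((𝓕 f' : L2R) l) * (𝓕 g : L2R) l := integral_conj_mul_fourier _ _
    _ = _ := by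
        refine integral_congr_ae ?_
        filter_upwards [h2] with x hx
        rw [hf', hx, sub_neg_eq_add]

theorem integral_schwartz_fourierInv_mul_eq (φ : 𝓢(ℝ, ℂ)) {f : ℝ → ℂ} (hf : Integrable f) :
    ∫ x, (𝓕⁻ φ) x * f x = ∫ x, φ x * (𝓕⁻ f) x := by
  have hL : (-innerₗ ℝ).flip = -innerₗ ℝ := by
    ext; simp
  have := VectorFourier.integral_fourierIntegral_smul_eq_flip (μ := volume) (ν := volume)
    (L := -innerₗ ℝ) (f := φ) (g := f) Real.continuous_fourierChar
    (by simpa using! continuous_inner.neg) φ.integrable hf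
  rw [hL] at this
  rw [SchwartzMap.fourierInv_coe]
  exact this

theorem integral_schwartz_fourier_mul_eq (φ : 𝓢(ℝ, ℂ)) {f : ℝ → ℂ} (hf : Integrable f) :
    ∫ x, (𝓕 φ) x * f x = ∫ x, φ x * (𝓕 f) x := by
  have hL : (innerₗ ℝ).flip = innerₗ ℝ := by
    ext; simp
  have := VectorFourier.integral_fourierIntegral_smul_eq_flip (μ := volume) (ν := volume)
    (L := innerₗ ℝ) (f := φ) (g := f) Real.continuous_fourierChar
    (by simpa using! continuous_inner) φ.integrable hf
  rw [hL] at this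
  rw [SchwartzMap.fourier_coe]
  exact this

theorem continuous_fourierInv_of_integrable {f : ℝ → ℂ} (hf : Integrable f) :
    Continuous (𝓕⁻ f) :=
  VectorFourier.fourierIntegral_continuous Real.continuous_fourierChar
    (by simpa using! continuous_inner.neg) hf

theorem continuous_fourier_of_integrable {f : ℝ → ℂ} (hf : Integrable f) :
    Continuous (𝓕 f) :=
  VectorFourier.fourierIntegral_continuous Real.continuous_fourierChar
    (by simpa using! continuous_inner) hf

theorem fourierInv_L2_ae_eq_of_integrable {f : L2R} (hf : Integrable (f : ℝ → ℂ)) :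
    (𝓕⁻ f : L2R) =ᵐ[volume] 𝓕⁻ (f : ℝ → ℂ) := by
  refine ae_eq_of_integral_schwartz_mul_eq (locallyIntegrable_L2 _)
    (continuous_fourierInv_of_integrable hf).locallyIntegrable fun φ => ?_
  rw [← integral_fourierInv_mul_L2, integral_schwartz_fourierInv_mul_eq φ hf]

theorem ae_eq_fourier_fourierInv {f : ℝ → ℂ} (hf : Integrable f) (hf' : Integrable (𝓕⁻ f)) :
    f =ᵐ[volume] 𝓕 (𝓕⁻ f) := by
  refine ae_eq_of_integral_schwartz_mul_eq hf.locallyIntegrable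
    (continuous_fourier_of_integrable hf').locallyIntegrable fun φ => ?_
  have h1 := integral_schwartz_fourierInv_mul_eq (𝓕 φ) hf
  rw [FourierTransform.fourierInv_fourier_eq] at h1
  rw [h1, integral_schwartz_fourier_mul_eq φ hf']

theorem integrable_conj_mul {f g : ℝ → ℂ} (hf : MemLp f 2) (hg : MemLp g 2) :
    Integrable fun x => conj (f x) * g x := by
  have hc : MemLp (fun x => conj (f x)) 2 := hf.star
  exact hc.integrable_mul hg

theorem MeasureTheory.MemLp.comp_add_right {f : ℝ → ℂ} {p : ENNReal} (hf : MemLp f p) (s : ℝ) :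
    MemLp (fun x => f (x + s)) p :=
  hf.comp_measurePreserving (measurePreserving_add_right volume s)

/-! ### Functions in `H^{1/2}(ℝ)` -/

theorem integrable_norm_sq {f : ℝ → ℂ} (hf : MemLp f 2) : Integrable fun x => ‖f x‖ ^ 2 :=
  (memLp_two_iff_integrable_sq_norm hf.1).1 hf

theorem integral_norm_sq_fourier_L2 (f : L2R) :
    ∫ l, ‖(𝓕 f : L2R) l‖ ^ 2 = ∫ x, ‖f x‖ ^ 2 := by
  have h := integral_conj_mul_fourier f f
  have key : ∀ z : ℂ, conj z * z = ((‖z‖ ^ 2 : ℝ) : ℂ) := fun z => by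
    rw [Complex.conj_mul']; push_cast; rfl
  simp only [key] at h
  rw [integral_complex_ofReal, integral_complex_ofReal] at h
  exact_mod_cast h.symm

/-- The square of the Sobolev weight is `(1 + l²)^(1/2)`, which dominates `|l|`. -/
theorem integrable_abs_mul_norm_fourier_sq {Q : L2R} (hQ : MemHHalf Q) :
    Integrable fun l : ℝ => |l| * ‖(𝓕 Q : L2R) l‖ ^ 2 := by
  obtain ⟨f', hf'⟩ := memSobolev_iff_exists_smulLeftCLM_fourier.1 hQ
  rw [Lp.fourier_toTemperedDistribution_eq] at hf'
  set w : ℝ → ℝ := fun x => (1 + ‖x‖ ^ 2) ^ ((1 / 2 : ℝ) / 2) with hw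
  have hwt : (fun x => (w x : ℂ)).HasTemperateGrowth := by
    simp only [hw]; fun_prop
  have hwc : Continuous fun x => (w x : ℂ) := hwt.1.continuous
  have hae : (fun l => (w l : ℂ) * (𝓕 Q : L2R) l) =ᵐ[volume] f' := by
    refine ae_eq_of_integral_schwartz_mul_eq ?_ (locallyIntegrable_L2 _) fun φ => ?_
    · simpa only [smul_eq_mul, mul_comm] using! (locallyIntegrable_L2 (𝓕 Q)).smul_continuous hwc
    · have h := congrArg (fun T : 𝓢'(ℝ, ℂ) => T φ) hf'
      simp only [smulLeftCLM_apply_apply, Lp.toTemperedDistribution_apply, smul_eq_mul] at h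
      rw [← h]
      refine integral_congr_ae (ae_of_all _ fun x => ?_)
      simp only
      rw [SchwartzMap.smulLeftCLM_apply_apply hwt, smul_eq_mul]
      ring
  have hint := integrable_norm_sq (Lp.memLp f')
  refine hint.mono' ?_ ?_
  · exact continuous_abs.aestronglyMeasurable.mul ((Lp.aestronglyMeasurable _).norm.pow 2)
  · filter_upwards [hae] with l hl
    have hwn : 0 ≤ w l := by simp only [hw]; positivity
    have h0 : (0 : ℝ) ≤ 1 + ‖l‖ ^ 2 := by positivity
    have hw4 : (w l ^ 2) ^ 2 = 1 + l ^ 2 := by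
      simp only [hw]
      rw [← Real.rpow_natCast, ← Real.rpow_natCast, ← Real.rpow_mul h0, ← Real.rpow_mul h0]
      norm_num
    have hle : |l| ≤ w l ^ 2 := abs_le_of_sq_le_sq (by rw [hw4]; linarith) (by positivity)
    rw [← hl, Real.norm_of_nonneg (by positivity), norm_mul (w l : ℂ), mul_pow, Complex.norm_real,
      Real.norm_of_nonneg hwn]
    exact mul_le_mul_of_nonneg_right hle (by positivity)

theorem norm_char_sub_one_le (t : ℝ) : ‖char t - 1‖ ≤ 2 * Real.pi * |t| := by
  have h := Real.norm_exp_I_mul_ofReal_sub_one_le (x := 2 * Real.pi * t)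
  rw [char, mul_comm]
  refine h.trans (le_of_eq ?_)
  rw [Real.norm_eq_abs, abs_mul, abs_of_pos Real.two_pi_pos]

theorem norm_char_sub_one_le_two (t : ℝ) : ‖char t - 1‖ ≤ 2 := by
  refine (norm_sub_le _ _).trans ?_
  rw [norm_char, norm_one]; norm_num

/-- The product of the linear bound and the trivial bound `2`. Being of first order in `t`, it
provides a dominating function that uses only half a derivative. -/
theorem norm_char_sub_one_sq_le (t : ℝ) : ‖char t - 1‖ ^ 2 ≤ 4 * Real.pi * |t| := by
  have h1 := norm_char_sub_one_le t
  have h2 := norm_char_sub_one_le_two t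
  have h0 := norm_nonneg (char t - 1)
  nlinarith

theorem fourier_sub_translate {Q T : L2R} {s : ℝ}
    (hT : T =ᵐ[volume] fun x => Q (x + s) - Q x) :
    (𝓕 T : L2R) =ᵐ[volume] fun l => (char (s * l) - 1) * (𝓕 Q : L2R) l := by
  set g : L2R := ((Lp.memLp Q).comp_add_right s).toLp _ with hg
  have h1 : g =ᵐ[volume] fun x => Q (x + s) := ((Lp.memLp Q).comp_add_right s).coeFn_toLp
  have h2 := fourier_comp_add_right_L2 h1
  have h3 : T = g - Q := by
    refine Lp.ext ?_
    filter_upwards [hT, h1, Lp.coeFn_sub g Q] with x a b c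
    rw [a, c, Pi.sub_apply, b]
  have h4 : 𝓕 T = 𝓕 g - 𝓕 Q := by
    rw [h3]; exact (Lp.fourierTransformₗᵢ ℝ ℂ).map_sub g Q
  rw [h4]
  filter_upwards [h2, Lp.coeFn_sub (𝓕 g : L2R) (𝓕 Q)] with l a b
  rw [b, Pi.sub_apply, a]; ring

theorem memLp_sub_translate (Q : L2R) (s : ℝ) : MemLp (fun x => Q (x + s) - Q x) 2 :=
  ((Lp.memLp Q).comp_add_right s).sub (Lp.memLp Q)

theorem integral_norm_sub_translate_sq (Q : L2R) (s : ℝ) :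
    ∫ x, ‖Q (x + s) - Q x‖ ^ 2 = ∫ l, ‖char (s * l) - 1‖ ^ 2 * ‖(𝓕 Q : L2R) l‖ ^ 2 := by
  have h1 := (memLp_sub_translate Q s).coeFn_toLp
  have h2 := fourier_sub_translate h1
  calc _ = ∫ x, ‖(memLp_sub_translate Q s).toLp _ x‖ ^ 2 := by
        refine integral_congr_ae ?_
        filter_upwards [h1] with x hx
        rw [hx]
    _ = _ := (integral_norm_sq_fourier_L2 _).symm
    _ = _ := by
        refine integral_congr_ae ?_
        filter_upwards [h2] with x hx
        rw [hx, norm_mul, mul_pow]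

/-- The `L²` modulus of continuity of an `H^{1/2}` function is `o(s^{1/2})`. -/
theorem tendsto_integral_norm_sub_translate_sq_div {Q : L2R} (hQ : MemHHalf Q) :
    Tendsto (fun s : ℝ => (∫ x, ‖Q (x + s) - Q x‖ ^ 2) / s) (𝓝[>] 0) (𝓝 0) := by
  have h0 : (0 : ℝ) = ∫ _ : ℝ, (0 : ℝ) := by simp
  simp only [integral_norm_sub_translate_sq, ← integral_div]
  rw [show 𝓝 (0 : ℝ) = 𝓝 (∫ _ : ℝ, (0 : ℝ)) by rw [← h0]]
  refine tendsto_integral_filter_of_dominated_convergence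
    (fun l => 4 * Real.pi * (|l| * ‖(𝓕 Q : L2R) l‖ ^ 2)) ?_ ?_ ?_ ?_
  · refine Eventually.of_forall fun s => ?_
    refine AEStronglyMeasurable.div₀ ?_ aestronglyMeasurable_const
    refine AEStronglyMeasurable.mul ?_ ((Lp.aestronglyMeasurable _).norm.pow 2)
    exact (((continuous_char.comp (continuous_const.mul continuous_id)).sub
      continuous_const).norm.pow 2).aestronglyMeasurable
  · filter_upwards [self_mem_nhdsWithin] with s hs
    have hs : 0 < s := hs
    refine ae_of_all _ fun l => ?_
    rw [Real.norm_of_nonneg (by positivity), div_le_iff₀ hs]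
    have := mul_le_mul_of_nonneg_right (norm_char_sub_one_sq_le (s * l))
      (by positivity : 0 ≤ ‖(𝓕 Q : L2R) l‖ ^ 2)
    rw [abs_mul, abs_of_pos hs] at this
    linarith
  · exact (integrable_abs_mul_norm_fourier_sq hQ).const_mul _
  · refine ae_of_all _ fun l => ?_
    set c := ‖(𝓕 Q : L2R) l‖ ^ 2
    have hup : Tendsto (fun s : ℝ => s * ((2 * Real.pi * |l|) ^ 2 * c)) (𝓝[>] 0) (𝓝 0) := by
      have : Tendsto (fun s : ℝ => s * ((2 * Real.pi * |l|) ^ 2 * c)) (𝓝 0) (𝓝 (0 * _)) :=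
        tendsto_id.mul_const _
      rw [zero_mul] at this
      exact this.mono_left nhdsWithin_le_nhds
    refine tendsto_of_tendsto_of_tendsto_of_le_of_le' tendsto_const_nhds hup ?_ ?_
    · filter_upwards [self_mem_nhdsWithin] with s hs
      have hs : 0 < s := hs
      positivity
    · filter_upwards [self_mem_nhdsWithin] with s hs
      have hs : 0 < s := hs
      rw [div_le_iff₀ hs]
      have h1 := norm_char_sub_one_le (s * l)
      rw [abs_mul, abs_of_pos hs] at h1
      have h2 : ‖char (s * l) - 1‖ ^ 2 ≤ (2 * Real.pi * (s * |l|)) ^ 2 :=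
        pow_le_pow_left₀ (norm_nonneg _) h1 2
      have := mul_le_mul_of_nonneg_right h2 (by positivity : 0 ≤ c)
      linarith

/-! ### Low frequencies and the embedding into `L⁸` -/

theorem integral_inv_one_add_abs_le {N : ℝ} (hN : 0 ≤ N) :
    ∫ l in Set.Icc (-N) N, (1 + |l|)⁻¹ = 2 * Real.log (1 + N) := by
  have hc : Continuous fun l : ℝ => (1 + |l|)⁻¹ :=
    (continuous_const.add continuous_abs).inv₀ fun l => (by positivity : (0 : ℝ) < 1 + |l|).ne'
  have hpos : ∫ l in (0 : ℝ)..N, (1 + |l|)⁻¹ = Real.log (1 + N) := by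
    rw [intervalIntegral.integral_eq_sub_of_hasDerivAt (f := fun l => Real.log (1 + l))]
    · simp
    · intro l hl
      rw [Set.uIcc_of_le hN] at hl
      have h1 : (0 : ℝ) < 1 + l := by linarith [hl.1]
      have := ((hasDerivAt_id l).const_add 1).log h1.ne'
      simpa [abs_of_nonneg hl.1] using this
    · exact hc.intervalIntegrable _ _
  have hneg : ∫ l in (-N)..0, (1 + |l|)⁻¹ = Real.log (1 + N) := by
    rw [← hpos, ← neg_zero, ← intervalIntegral.integral_comp_neg]
    simp
  rw [integral_Icc_eq_integral_Ioc, ← intervalIntegral.integral_of_le (by linarith),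
    ← intervalIntegral.integral_add_adjacent_intervals (b := 0) (hc.intervalIntegrable _ _)
      (hc.intervalIntegrable _ _), hpos, hneg]
  ring

/-- Weighted AM-GM splits `|q|` into `(1 + |l|)|q|²` and `(1 + |l|)⁻¹`. The second integrates to
only a logarithm of the cutoff, so a cutoff as high as `u⁸` still costs a multiple of `u`; the `18`
comes from `log (1 + u⁸) ≤ 9u²`. -/
theorem integral_low_frequencies_le {q : ℝ → ℂ} (hq : MemLp q 2)
    (hq' : Integrable fun l : ℝ => |l| * ‖q l‖ ^ 2) {u : ℝ} (hu : 1 ≤ u) :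
    IntegrableOn q (Set.Icc (-u ^ 8) (u ^ 8)) ∧ ∫ l in Set.Icc (-u ^ 8) (u ^ 8), ‖q l‖ ≤
      u * ((∫ l, (1 + |l|) * ‖q l‖ ^ 2) + 18) / 2 := by
  have hu0 : 0 < u := by linarith
  set S := Set.Icc (-u ^ 8) (u ^ 8)
  have hint : Integrable fun l : ℝ => (1 + |l|) * ‖q l‖ ^ 2 := by
    simp only [add_mul, one_mul]
    exact (integrable_norm_sq hq).add hq'
  have hc : Continuous fun l : ℝ => (1 + |l|)⁻¹ :=
    (continuous_const.add continuous_abs).inv₀ fun l => (by positivity : (0 : ℝ) < 1 + |l|).ne'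
  have hcS : IntegrableOn (fun l : ℝ => (1 + |l|)⁻¹) S := hc.integrableOn_Icc
  have hbound : ∀ l : ℝ, ‖q l‖ ≤ u / 2 * ((1 + |l|) * ‖q l‖ ^ 2) + (2 * u)⁻¹ * (1 + |l|)⁻¹ := by
    intro l
    have hw : 0 < 1 + |l| := by positivity
    have h := sq_nonneg (u * (1 + |l|) * ‖q l‖ - 1)
    rw [← mul_inv, ← sub_nonneg]
    have : u / 2 * ((1 + |l|) * ‖q l‖ ^ 2) + (2 * u * (1 + |l|))⁻¹ - ‖q l‖ =
        (u * (1 + |l|) * ‖q l‖ - 1) ^ 2 * (2 * u * (1 + |l|))⁻¹ := by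
      field_simp; ring
    rw [this]; positivity
  have hrhs : IntegrableOn
      (fun l : ℝ => u / 2 * ((1 + |l|) * ‖q l‖ ^ 2) + (2 * u)⁻¹ * (1 + |l|)⁻¹) S :=
    (hint.integrableOn.const_mul _).add (hcS.const_mul _)
  have hqS : IntegrableOn q S :=
    hrhs.mono' hq.1.restrict (ae_of_all _ hbound)
  refine ⟨hqS, ?_⟩
  calc ∫ l in S, ‖q l‖ ≤
        ∫ l in S, (u / 2 * ((1 + |l|) * ‖q l‖ ^ 2) + (2 * u)⁻¹ * (1 + |l|)⁻¹) :=
        integral_mono hqS.norm hrhs hbound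
    _ = u / 2 * (∫ l in S, (1 + |l|) * ‖q l‖ ^ 2) + (2 * u)⁻¹ * (2 * Real.log (1 + u ^ 8)) := by
        rw [integral_add (hint.integrableOn.const_mul _) (hcS.const_mul _), integral_const_mul,
          integral_const_mul, ← integral_inv_one_add_abs_le (by positivity)]
    _ ≤ u / 2 * (∫ l, (1 + |l|) * ‖q l‖ ^ 2) + (2 * u)⁻¹ * (2 * (9 * u ^ 2)) := by
        have h1 : Real.log (1 + u ^ 8) ≤ 9 * u ^ 2 := by
          have h8 : (1 : ℝ) ≤ u ^ 8 := one_le_pow₀ hu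
          have h2 : Real.log (1 + u ^ 8) ≤ Real.log (2 * u ^ 8) :=
            Real.log_le_log (by positivity) (by linarith)
          rw [Real.log_mul (by norm_num) (by positivity), Real.log_pow] at h2
          have h3 := Real.log_le_sub_one_of_pos hu0
          have h4 := Real.log_le_sub_one_of_pos (zero_lt_two' ℝ)
          push_cast at h2
          nlinarith
        gcongr
        · exact ae_of_all _ fun l => by positivity
        · exact Measure.restrict_le_self
    _ = _ := by field_simp; ring

/-- Cut `𝓕 Q` at `|l| = u⁸`. The low part is bounded by `t / 2` almost everywhere, so `|Q| > t`
forces the high part above `t / 2`; its squared `L²` norm is at most `M u⁻⁸`, and Chebyshev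
concludes. -/
theorem volume_lt_norm_le {Q : L2R} (hQ : MemHHalf Q) {u t : ℝ} (hu : 1 ≤ u)
    (ht : u * ((∫ l, (1 + |l|) * ‖(𝓕 Q : L2R) l‖ ^ 2) + 18) ≤ t) :
    volume {x | t < ‖Q x‖} ≤
      ENNReal.ofReal (4 * (∫ l, (1 + |l|) * ‖(𝓕 Q : L2R) l‖ ^ 2) * (u ^ 8)⁻¹ * (t ^ 2)⁻¹) := by
  have hu0 : 0 < u := by linarith
  set q : L2R := 𝓕 Q with hq
  set M := ∫ l, (1 + |l|) * ‖q l‖ ^ 2 with hM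
  have hM0 : 0 ≤ M := integral_nonneg fun l => by positivity
  have ht0 : 0 < t := lt_of_lt_of_le (by positivity) ht
  have hint : Integrable fun l : ℝ => (1 + |l|) * ‖q l‖ ^ 2 := by
    simp only [add_mul, one_mul]
    exact (integrable_norm_sq (Lp.memLp q)).add (integrable_abs_mul_norm_fourier_sq hQ)
  obtain ⟨hi, hlow⟩ := integral_low_frequencies_le (Lp.memLp q)
    (integrable_abs_mul_norm_fourier_sq hQ) hu
  set S := Set.Icc (-u ^ 8) (u ^ 8) with hS
  have hSm : MeasurableSet S := measurableSet_Icc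
  have hmem : MemLp (S.indicator q) 2 := (Lp.memLp q).indicator hSm
  set ql : L2R := hmem.toLp _ with hql
  have hqlae : ql =ᵐ[volume] S.indicator q := hmem.coeFn_toLp
  have hqli : Integrable (ql : ℝ → ℂ) := (hi.integrable_indicator hSm).congr hqlae.symm
  have hlowb : ∀ᵐ x, ‖(𝓕⁻ ql : L2R) x‖ ≤ t / 2 := by
    filter_upwards [fourierInv_L2_ae_eq_of_integrable hqli] with x hx
    rw [hx]
    refine (VectorFourier.norm_fourierIntegral_le_integral_norm _ _ _ _ _).trans ?_
    calc ∫ l, ‖ql l‖ = ∫ l, S.indicator (fun l => ‖q l‖) l := by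
          refine integral_congr_ae ?_
          filter_upwards [hqlae] with l hl
          rw [hl, norm_indicator_eq_indicator_norm]
      _ = ∫ l in S, ‖q l‖ := integral_indicator hSm
      _ ≤ t / 2 := by linarith
  set H : L2R := Q - 𝓕⁻ ql with hH
  have hHae : ∀ᵐ x, H x = Q x - (𝓕⁻ ql : L2R) x := Lp.coeFn_sub Q (𝓕⁻ ql : L2R)
  have hHF : 𝓕 H = q - ql := by
    rw [hH]
    calc 𝓕 (Q - 𝓕⁻ ql) = 𝓕 Q - 𝓕 (𝓕⁻ ql) := (Lp.fourierTransformₗᵢ ℝ ℂ).map_sub _ _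
      _ = _ := by rw [FourierTransform.fourier_fourierInv_eq]
  have hHn : ∫ x, ‖H x‖ ^ 2 ≤ M * (u ^ 8)⁻¹ := by
    rw [← integral_norm_sq_fourier_L2, hHF, hM, ← integral_mul_const]
    refine integral_mono_ae (integrable_norm_sq (Lp.memLp _)) (hint.mul_const _) ?_
    filter_upwards [Lp.coeFn_sub q ql, hqlae] with l h1 h2
    rw [h1, Pi.sub_apply, h2]
    by_cases hl : l ∈ S
    · rw [Set.indicator_of_mem hl, sub_self, norm_zero, zero_pow two_ne_zero]
      positivity
    · rw [Set.indicator_of_notMem hl, sub_zero, mul_right_comm]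
      refine le_mul_of_one_le_left (by positivity) ?_
      rw [← div_eq_mul_inv, one_le_div (by positivity)]
      have : u ^ 8 < |l| := by
        by_contra hcon
        exact hl (abs_le.1 (not_lt.1 hcon))
      linarith
  have hsub : {x | t < ‖Q x‖} ≤ᵐ[volume] {x | (t / 2) ^ 2 ≤ ‖H x‖ ^ 2} := by
    filter_upwards [hlowb, hHae] with x h1 h2 hx
    have hx : t < ‖Q x‖ := hx
    change (t / 2) ^ 2 ≤ ‖H x‖ ^ 2
    refine pow_le_pow_left₀ (by positivity) ?_ 2
    rw [h2]
    have := norm_sub_norm_le (Q x) ((𝓕⁻ ql : L2R) x)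
    linarith
  refine (measure_mono_ae hsub).trans ?_
  have hmk := mul_meas_ge_le_integral_of_nonneg (μ := volume) (f := fun x => ‖H x‖ ^ 2)
    (ae_of_all _ fun x => by positivity) (integrable_norm_sq (Lp.memLp H)) ((t / 2) ^ 2)
  have hfin : volume {x | (t / 2) ^ 2 ≤ ‖H x‖ ^ 2} ≠ ⊤ :=
    ((integrable_norm_sq (Lp.memLp H)).measure_ge_lt_top (by positivity)).ne
  rw [← ENNReal.ofReal_toReal hfin]
  refine ENNReal.ofReal_le_ofReal ?_
  have h3 : (t / 2) ^ 2 * (volume {x | (t / 2) ^ 2 ≤ ‖H x‖ ^ 2}).toReal ≤ M * (u ^ 8)⁻¹ :=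
    hmk.trans hHn
  rw [← le_div_iff₀' (by positivity)] at h3
  refine h3.trans (le_of_eq ?_)
  field_simp
  ring

theorem volume_lt_norm_le_sq (Q : L2R) {t : ℝ} (ht : 0 < t) :
    volume {x | t < ‖Q x‖} ≤ ENNReal.ofReal ((∫ x, ‖Q x‖ ^ 2) * (t ^ 2)⁻¹) := by
  have hi := integrable_norm_sq (Lp.memLp Q)
  have hsub : {x | t < ‖Q x‖} ⊆ {x | t ^ 2 ≤ ‖Q x‖ ^ 2} := fun x hx =>
    pow_le_pow_left₀ ht.le (le_of_lt hx) 2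
  refine (measure_mono hsub).trans ?_
  have hmk := mul_meas_ge_le_integral_of_nonneg (μ := volume) (f := fun x => ‖Q x‖ ^ 2)
    (ae_of_all _ fun x => by positivity) hi (t ^ 2)
  have hfin : volume {x | t ^ 2 ≤ ‖Q x‖ ^ 2} ≠ ⊤ := (hi.measure_ge_lt_top (by positivity)).ne
  rw [← ENNReal.ofReal_toReal hfin]
  refine ENNReal.ofReal_le_ofReal ?_
  rw [← div_eq_mul_inv, le_div_iff₀' (by positivity)]
  exact hmk

/-- The Sobolev embedding `H^{1/2}(ℝ) ⊆ L⁸(ℝ)`. -/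
theorem memLp_eight {Q : L2R} (hQ : MemHHalf Q) : MemLp Q 8 := by
  refine ⟨Lp.aestronglyMeasurable Q, ?_⟩
  rw [eLpNorm_lt_top_iff_lintegral_rpow_enorm_lt_top (by norm_num) (by norm_num)]
  have h8 : ∀ x, ‖Q x‖ₑ ^ (8 : ENNReal).toReal = ENNReal.ofReal (‖Q x‖ ^ (8 : ℝ)) := by
    intro x
    rw [← ofReal_norm, ENNReal.ofReal_rpow_of_nonneg (norm_nonneg _) (by norm_num)]
    norm_num
  simp only [h8]
  rw [lintegral_rpow_eq_lintegral_meas_lt_mul volume (ae_of_all _ fun x => norm_nonneg _)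
    (Lp.aestronglyMeasurable Q).norm.aemeasurable (by norm_num)]
  refine ENNReal.mul_lt_top ENNReal.ofReal_lt_top ?_
  set M := ∫ l, (1 + |l|) * ‖(𝓕 Q : L2R) l‖ ^ 2 with hM
  have hM0 : 0 ≤ M := integral_nonneg fun l => by positivity
  set K := M + 18 with hK
  have hK0 : 0 < K := by positivity
  set A := ∫ x, ‖Q x‖ ^ 2
  have hA0 : 0 ≤ A := integral_nonneg fun l => by positivity
  have hbd1 : ∀ t ∈ Set.Ioc 0 K, volume {x | t < ‖Q x‖} * ENNReal.ofReal (t ^ ((8 : ℝ) - 1)) ≤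
      ENNReal.ofReal (A * K ^ 5) := by
    intro t ht
    refine (mul_le_mul_left (volume_lt_norm_le_sq Q ht.1) _).trans ?_
    rw [← ENNReal.ofReal_mul (by positivity)]
    refine ENNReal.ofReal_le_ofReal ?_
    have h0 := ht.1
    have : t ^ ((8 : ℝ) - 1) = t ^ 7 := by rw [← Real.rpow_natCast]; norm_num
    rw [this]
    calc A * (t ^ 2)⁻¹ * t ^ 7 = A * t ^ 5 := by field_simp
      _ ≤ A * K ^ 5 := by have := ht.2; gcongr
  -- With `u = t / K`, the largest value allowed in `volume_lt_norm_le`, the level sets have measure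
  -- `O(t⁻¹⁰)`, which beats the weight `t⁷`.
  have hbd2 : ∀ t ∈ Set.Ioi K, volume {x | t < ‖Q x‖} * ENNReal.ofReal (t ^ ((8 : ℝ) - 1)) ≤
      ENNReal.ofReal (4 * M * K ^ 8 * t ^ (-3 : ℝ)) := by
    intro t ht
    have hKt : K < t := ht
    have h0 : 0 < t := hK0.trans hKt
    have hu : 1 ≤ t / K := by rw [one_le_div hK0]; exact hKt.le
    refine (mul_le_mul_left (volume_lt_norm_le hQ hu (t := t) ?_) _).trans ?_
    · rw [← hM, ← hK]; field_simp; exact le_refl _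
    rw [← ENNReal.ofReal_mul (by positivity)]
    refine ENNReal.ofReal_le_ofReal (le_of_eq ?_)
    have h7 : t ^ ((8 : ℝ) - 1) = t ^ 7 := by rw [← Real.rpow_natCast]; norm_num
    have h3 : t ^ (-3 : ℝ) = (t ^ 3)⁻¹ := by
      rw [Real.rpow_neg h0.le, ← Real.rpow_natCast]; norm_num
    rw [h7, h3, ← hM]
    field_simp
  rw [← Set.Ioc_union_Ioi_eq_Ioi hK0.le]
  refine (lintegral_union_le _ _ _).trans_lt (ENNReal.add_lt_top.2 ⟨?_, ?_⟩)
  · refine (setLIntegral_mono measurable_const hbd1).trans_lt ?_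
    rw [setLIntegral_const]
    exact ENNReal.mul_lt_top ENNReal.ofReal_lt_top (by simp)
  · refine (setLIntegral_mono (by fun_prop) hbd2).trans_lt ?_
    have hint : IntegrableOn (fun t : ℝ => 4 * M * K ^ 8 * t ^ (-3 : ℝ)) (Set.Ioi K) :=
      (integrableOn_Ioi_rpow_of_lt (by norm_num) hK0).const_mul _
    exact hint.lintegral_lt_top

/-! ### The equation on the Fourier side -/

/-- The symbol of `√(-Δ) + i∂ₓ`. -/
noncomputable def symb (l : ℝ) : ℝ := 2 * Real.pi * (|l| - l)

theorem continuous_symb : Continuous symb := by unfold symb; fun_prop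

theorem symb_nonneg (l : ℝ) : 0 ≤ symb l :=
  mul_nonneg Real.two_pi_pos.le (sub_nonneg.2 (le_abs_self l))

theorem symb_le (l : ℝ) : symb l ≤ 4 * Real.pi * |l| := by
  unfold symb; nlinarith [neg_abs_le l, Real.pi_pos]

theorem symb_of_nonneg {l : ℝ} (hl : 0 ≤ l) : symb l = 0 := by
  rw [symb, abs_of_nonneg hl]; ring

theorem symb_of_nonpos {l : ℝ} (hl : l ≤ 0) : symb l = -(4 * Real.pi * l) := by
  rw [symb, abs_of_nonpos hl]; ring

theorem memLp_norm_pow_three_mul {f : ℝ → ℂ} (h8 : MemLp f 8) :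
    MemLp (fun x => ((‖f x‖ ^ 3 : ℝ) : ℂ) * f x) 2 := by
  have h := h8.norm_rpow_div (q := 4)
  have h2 : (8 : ENNReal) / 4 = 2 := by
    rw [show (8 : ENNReal) = 2 * 4 by norm_num]
    exact ENNReal.mul_div_cancel_right (by norm_num) (by norm_num)
  rw [h2] at h
  refine h.of_le ?_ (ae_of_all _ fun x => ?_)
  · exact (Complex.continuous_ofReal.comp_aestronglyMeasurable (h8.1.norm.pow 3)).mul h8.1
  · have h4 : ‖f x‖ ^ (4 : ENNReal).toReal = ‖f x‖ ^ 4 := by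
      rw [← Real.rpow_natCast]; norm_num
    rw [h4, norm_mul, Complex.norm_real, Real.norm_of_nonneg (by positivity),
      Real.norm_of_nonneg (by positivity)]
    exact le_of_eq (by ring)

theorem integrable_schwartz_mul (φ : 𝓢(ℝ, ℂ)) {f : ℝ → ℂ} (hf : MemLp f 2) :
    Integrable fun x => φ x * f x :=
  (φ.memLp 2).integrable_mul hf

theorem derivCLM_apply_fourier (Q : L2R) (ψ : 𝓢(ℝ, ℂ)) :
    derivCLM ℂ (Q : 𝓢'(ℝ, ℂ)) (𝓕 ψ) =
      ∫ l, ψ l * ((2 * Real.pi * l : ℝ) * Complex.I * (𝓕 Q : L2R) l) := by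
  have hid : (fun x : ℝ => (inner ℝ x (1 : ℝ))).HasTemperateGrowth := by fun_prop
  have h1 : SchwartzMap.derivCLM ℂ ℂ (𝓕 ψ) =
      𝓕 (-(2 * Real.pi * Complex.I) •
        SchwartzMap.smulLeftCLM ℂ (fun x : ℝ => (inner ℝ x (1 : ℝ))) ψ) := by
    rw [← SchwartzMap.lineDerivOp_fourier_eq]
    ext x
    simp [SchwartzMap.lineDerivOp_apply_eq_fderiv]
  rw [derivCLM_apply_apply, h1, map_neg, Lp.toTemperedDistribution_apply]
  simp only [smul_eq_mul]
  rw [integral_fourier_mul_L2, ← integral_neg]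
  refine integral_congr_ae (ae_of_all _ fun l => ?_)
  simp only [smul_apply, SchwartzMap.smulLeftCLM_apply_apply hid]
  simp
  ring

/-- The equation is tested against `𝓕 ψ`. The term `i∂ₓ` contributes the multiplier `-2πl`, which
cancels `2π|l|` on the positive frequencies. -/
theorem fourier_eq_symb_mul {ω : ℝ} {Q G : L2R} (hQ : MemHHalf Q)
    (heq : SolvesProfileEquation ω Q)
    (hG : G =ᵐ[volume] fun x => ((‖Q x‖ ^ 3 - ω : ℝ) : ℂ) * Q x) :
    (𝓕 G : L2R) =ᵐ[volume] fun l => (symb l : ℂ) * (𝓕 Q : L2R) l := by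
  have hQ8 := memLp_eight hQ
  refine ae_eq_of_integral_schwartz_mul_eq (locallyIntegrable_L2 _) ?_ fun ψ => ?_
  · simpa only [smul_eq_mul, mul_comm] using! (locallyIntegrable_L2 (𝓕 Q)).smul_continuous
      (Complex.continuous_ofReal.comp continuous_symb)
  have h := heq (𝓕 ψ)
  rw [derivCLM_apply_fourier, sqrtNegLaplacian, Lp.toTemperedDistribution_apply,
    FourierTransform.fourierInv_fourier_eq] at h
  simp only [smul_eq_mul] at h
  have hF : ∫ x, 𝓕 ψ x * G x = (∫ x, 𝓕 ψ x * (((‖Q x‖ ^ 3 : ℝ) : ℂ) * Q x)) -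
      ω * ∫ x, 𝓕 ψ x * Q x := by
    rw [← integral_const_mul, ← integral_sub
      (integrable_schwartz_mul _ (memLp_norm_pow_three_mul hQ8))
      ((integrable_schwartz_mul _ (Lp.memLp Q)).const_mul _)]
    refine integral_congr_ae ?_
    filter_upwards [hG] with x hx
    rw [hx]; push_cast; ring
  rw [← integral_fourier_mul_L2, hF]
  have hsplit : ∫ l, ψ l * ((symb l : ℂ) * (𝓕 Q : L2R) l) =
      (∫ l, ((|2 * Real.pi * l| : ℝ) : ℂ) * (𝓕 Q : L2R) l * ψ l) +
      Complex.I * ∫ l, ψ l * ((2 * Real.pi * l : ℝ) * Complex.I * (𝓕 Q : L2R) l) := by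
    have hid : (fun x : ℝ => (x : ℂ)).HasTemperateGrowth := by fun_prop
    have hi : Integrable fun l : ℝ => (l : ℂ) * (ψ l * (𝓕 Q : L2R) l) := by
      have := integrable_schwartz_mul
        (SchwartzMap.smulLeftCLM ℂ (fun x : ℝ => (x : ℂ)) ψ) (Lp.memLp (𝓕 Q : L2R))
      refine this.congr (ae_of_all _ fun l => ?_)
      simp only [SchwartzMap.smulLeftCLM_apply_apply hid, smul_eq_mul]
      ring
    have hi2 : Integrable fun l : ℝ => ((|l| : ℝ) : ℂ) * (ψ l * (𝓕 Q : L2R) l) := by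
      refine hi.mono ?_ (ae_of_all _ fun l => by simp)
      exact (Complex.continuous_ofReal.comp continuous_abs).aestronglyMeasurable.mul
        (ψ.continuous.aestronglyMeasurable.mul (Lp.aestronglyMeasurable _))
    rw [← integral_const_mul, ← integral_add]
    · refine integral_congr_ae (ae_of_all _ fun l => ?_)
      simp only [symb, abs_mul, abs_of_pos Real.pi_pos, abs_two]
      push_cast
      linear_combination (-2 * Real.pi * l * ψ l * (𝓕 Q : L2R) l) * Complex.I_mul_I
    · refine (hi2.const_mul (2 * Real.pi)).congr (ae_of_all _ fun l => ?_)
      simp only [abs_mul, abs_of_pos Real.pi_pos, abs_two]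
      push_cast; ring
    · refine (hi.const_mul (-(2 * Real.pi))).congr (ae_of_all _ fun l => ?_)
      push_cast
      linear_combination (-2 * Real.pi * l * ψ l * (𝓕 Q : L2R) l) * Complex.I_mul_I
  rw [hsplit]
  linear_combination -h

/-! ### Functions of class `H^{1/2}` do not jump across a gap -/

/-- If the `L²` modulus of continuity of `u` is `o(s^{1/2})` and `‖u‖` omits the values in `(a, b)`
on a half-line, then `‖u‖` does not jump across the gap on that half-line. -/
theorem norm_le_of_gap {u : ℝ → ℂ} (hm : Measurable u) (hu : MemLp u 2)
    (hD : Tendsto (fun s : ℝ => (∫ x, ‖u (x + s) - u x‖ ^ 2) / s) (𝓝[>] 0) (𝓝 0))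
    {a b R : ℝ} (ha : 0 ≤ a) (hab : a < b)
    (hgap : ∀ᵐ x, R < x → ‖u x‖ ≤ a ∨ b ≤ ‖u x‖) : ∀ᵐ x, R < x → ‖u x‖ ≤ a := by
  set E : Set ℝ := {x | b ≤ ‖u x‖} with hE
  have hEm : MeasurableSet E := measurableSet_le measurable_const hm.norm
  have hb : 0 < b := ha.trans_lt hab
  have hba : 0 < b - a := sub_pos.2 hab
  have hEfin : volume E ≠ ⊤ := by
    have : E ⊆ {x | b ^ 2 ≤ ‖u x‖ ^ 2} := fun x hx => pow_le_pow_left₀ hb.le hx 2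
    exact ((measure_mono this).trans_lt
      ((integrable_norm_sq hu).measure_ge_lt_top (by positivity))).ne
  -- The points of the half-line where the translation by `h` crosses the gap.
  set S : ℝ → Set ℝ := fun h => {x | R < x ∧ ¬(x + h ∈ E ↔ x ∈ E)} with hS
  -- A crossing over `h₁ + h₂` happens in one of the two successive steps; `0 ≤ h₁` keeps the
  -- intermediate point in the half-line.
  have hsub : ∀ h₁ h₂ : ℝ, 0 ≤ h₁ →
      volume (S (h₁ + h₂)) ≤ volume (S h₁) + volume (S h₂) := by
    intro h₁ h₂ h0
    have hcov : S (h₁ + h₂) ⊆ S h₁ ∪ (fun x => x + h₁) ⁻¹' S h₂ := by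
      rintro x ⟨hx, hn⟩
      by_cases h : (x + h₁ ∈ E ↔ x ∈ E)
      · refine Or.inr ⟨by linarith, fun h' => hn ?_⟩
        rw [← h, ← h', add_assoc]
      · exact Or.inl ⟨hx, h⟩
    refine (measure_mono hcov).trans ((measure_union_le _ _).trans ?_)
    rw [measure_preimage_add_right]
  have hmul : ∀ (n : ℕ) (h : ℝ), 0 ≤ h → volume (S (n * h)) ≤ n * volume (S h) := by
    intro n h h0
    induction n with
    | zero => simp [hS]
    | succ n ih =>
      push_cast
      rw [add_mul, add_mul, one_mul, one_mul]
      exact (hsub _ _ (by positivity)).trans (add_le_add_left ih _)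
  have hcheb : ∀ h : ℝ, 0 < h →
      volume (S h) ≤ ENNReal.ofReal ((∫ x, ‖u (x + h) - u x‖ ^ 2) / (b - a) ^ 2) := by
    intro h h0
    have hsh : ∀ᵐ x, R < x + h → ‖u (x + h)‖ ≤ a ∨ b ≤ ‖u (x + h)‖ :=
      (measurePreserving_add_right volume h).quasiMeasurePreserving.ae hgap
    have hle : S h ≤ᵐ[volume] {x | (b - a) ^ 2 ≤ ‖u (x + h) - u x‖ ^ 2} := by
      filter_upwards [hgap, hsh] with x h1 h2 hx
      obtain ⟨hxR, hxn⟩ := hx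
      have h1 := h1 hxR
      have h2 := h2 (by linarith)
      change (b - a) ^ 2 ≤ ‖u (x + h) - u x‖ ^ 2
      refine pow_le_pow_left₀ hba.le ?_ 2
      by_cases hx1 : x ∈ E
      · have hx2 : x + h ∉ E := fun hx2 => hxn ⟨fun _ => hx1, fun _ => hx2⟩
        have h3 : ‖u (x + h)‖ ≤ a := h2.resolve_right hx2
        have h4 : b ≤ ‖u x‖ := hx1
        have h5 := norm_sub_norm_le (u x) (u (x + h))
        rw [norm_sub_rev] at h5
        linarith
      · have hx2 : x + h ∈ E := by
          by_contra hx2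
          exact hxn ⟨fun h => absurd h hx2, fun h => absurd h hx1⟩
        have h3 : ‖u x‖ ≤ a := h1.resolve_right hx1
        have h4 : b ≤ ‖u (x + h)‖ := hx2
        have h5 := norm_sub_norm_le (u (x + h)) (u x)
        linarith
    have hint : Integrable fun x => ‖u (x + h) - u x‖ ^ 2 :=
      integrable_norm_sq ((hu.comp_add_right h).sub hu)
    refine (measure_mono_ae hle).trans ?_
    have hfin : volume {x | (b - a) ^ 2 ≤ ‖u (x + h) - u x‖ ^ 2} ≠ ⊤ :=
      (hint.measure_ge_lt_top (by positivity)).ne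
    rw [← ENNReal.ofReal_toReal hfin]
    refine ENNReal.ofReal_le_ofReal ?_
    rw [le_div_iff₀' (by positivity)]
    exact mul_meas_ge_le_integral_of_nonneg (ae_of_all _ fun x => by positivity) hint _
  -- Cutting `h` into `n + 1` equal steps bounds `volume (S h)` by a constant times the modulus of
  -- continuity at `h / (n + 1)` divided by `h / (n + 1)`, which tends to `0`.
  have hzero : ∀ h : ℝ, 0 < h → volume (S h) = 0 := by
    intro h h0
    set D : ℝ → ℝ := fun s => ∫ x, ‖u (x + s) - u x‖ ^ 2 with hDdef
    have hseq : Tendsto (fun n : ℕ => h / ((n : ℝ) + 1)) atTop (𝓝[>] 0) := by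
      refine tendsto_nhdsWithin_iff.2 ⟨?_, Eventually.of_forall fun n => ?_⟩
      · exact Tendsto.div_atTop tendsto_const_nhds
          (tendsto_atTop_add_const_right _ _ tendsto_natCast_atTop_atTop)
      · exact div_pos h0 (by positivity)
    have hlim := hD.comp hseq
    have hlim2 : Tendsto (fun n : ℕ => ENNReal.ofReal
        (h / (b - a) ^ 2 * (D (h / ((n : ℝ) + 1)) / (h / ((n : ℝ) + 1))))) atTop (𝓝 0) := by
      have := ENNReal.tendsto_ofReal (hlim.const_mul (h / (b - a) ^ 2))
      simpa using! this
    refine le_antisymm (ge_of_tendsto' hlim2 fun n => ?_) zero_le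
    have hn : (0 : ℝ) < (n : ℝ) + 1 := by positivity
    have h1 := hmul (n + 1) (h / ((n : ℝ) + 1)) (by positivity)
    have h2 := hcheb (h / ((n : ℝ) + 1)) (by positivity)
    have h3 : ((n + 1 : ℕ) : ℝ) * (h / ((n : ℝ) + 1)) = h := by push_cast; field_simp
    rw [h3] at h1
    refine h1.trans ((mul_le_mul_right h2 _).trans (le_of_eq ?_))
    rw [← ENNReal.ofReal_natCast, ← ENNReal.ofReal_mul (by positivity)]
    congr 1
    simp only [hDdef]
    push_cast
    field_simp
  -- As almost no point crosses, the part of `E` beyond `R` moves arbitrarily far to the right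
  -- without losing measure. Since `E` has finite measure, that part is null.
  have hshift : ∀ n : ℕ, volume (E ∩ Set.Ioi R) ≤ volume (E ∩ Set.Ioi (R + ((n : ℝ) + 1))) := by
    intro n
    have hn : (0 : ℝ) < (n : ℝ) + 1 := by positivity
    have hcov : E ∩ Set.Ioi R ⊆
        S ((n : ℝ) + 1) ∪ (fun x => x + ((n : ℝ) + 1)) ⁻¹' (E ∩ Set.Ioi (R + ((n : ℝ) + 1))) := by
      rintro x ⟨hxE, hx⟩
      have hx : R < x := hx
      by_cases h : x + ((n : ℝ) + 1) ∈ E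
      · exact Or.inr ⟨h, add_lt_add_left hx _⟩
      · exact Or.inl ⟨hx, fun h' => h (h'.2 hxE)⟩
    refine (measure_mono hcov).trans ((measure_union_le _ _).trans ?_)
    rw [hzero _ hn, zero_add, measure_preimage_add_right]
  have hnull : volume (E ∩ Set.Ioi R) = 0 := by
    have hlim : Tendsto (fun n : ℕ => volume (E ∩ Set.Ioi (R + ((n : ℝ) + 1)))) atTop
        (𝓝 (volume (⋂ n : ℕ, E ∩ Set.Ioi (R + ((n : ℝ) + 1))))) := by
      refine tendsto_measure_iInter_atTop
        (fun n => (hEm.inter measurableSet_Ioi).nullMeasurableSet) ?_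
        ⟨0, ((measure_mono Set.inter_subset_left).trans_lt hEfin.lt_top).ne⟩
      intro n m hnm
      refine Set.inter_subset_inter_right _ (Set.Ioi_subset_Ioi ?_)
      have : (n : ℝ) ≤ m := by exact_mod_cast hnm
      linarith
    have hempty : (⋂ n : ℕ, E ∩ Set.Ioi (R + ((n : ℝ) + 1))) = ∅ := by
      refine Set.eq_empty_iff_forall_notMem.2 fun x hx => ?_
      obtain ⟨n, hn⟩ := exists_nat_gt (x - R)
      have h1 : R + ((n : ℝ) + 1) < x := (Set.mem_iInter.1 hx n).2
      linarith
    rw [hempty, measure_empty] at hlim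
    exact le_antisymm (ge_of_tendsto' hlim hshift) zero_le
  have hae : ∀ᵐ x, x ∉ E ∩ Set.Ioi R := measure_eq_zero_iff_ae_notMem.1 hnull
  filter_upwards [hgap, hae] with x h1 h2 hx
  exact (h1 hx).resolve_right fun h => h2 ⟨h, hx⟩

/-- The two-sided version of `norm_le_of_gap`, on a neighbourhood of infinity. -/
theorem norm_le_of_gap_abs {Q : L2R} (hQ : MemHHalf Q) {a b R : ℝ} (ha : 0 ≤ a) (hab : a < b)
    (hgap : ∀ᵐ x, R < |x| → ‖Q x‖ ≤ a ∨ b ≤ ‖Q x‖) : ∀ᵐ x, R < |x| → ‖Q x‖ ≤ a := by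
  -- For `R < 0` the condition `R < |x|` is void; the case `R = 0` misses only the null set `{0}`.
  wlog hR : 0 ≤ R generalizing R with H
  · have h1 := H (R := 0) (hgap.mono fun x hx _ => hx (by linarith [abs_nonneg x, not_le.1 hR]))
      le_rfl
    have h2 : ∀ᵐ x : ℝ, x ≠ 0 := by simp [ae_iff]
    filter_upwards [h1, h2] with x hx hx0 _
    exact hx (abs_pos.2 hx0)
  have hm : Measurable (Q : ℝ → ℂ) := (Lp.stronglyMeasurable Q).measurable
  have hD := tendsto_integral_norm_sub_translate_sq_div hQ
  have h1 := norm_le_of_gap hm (Lp.memLp Q) hD ha hab (R := R)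
    (hgap.mono fun x hx h => hx (h.trans_le (le_abs_self x)))
  have hneg : MeasurePreserving (fun x : ℝ => -x) volume volume := Measure.measurePreserving_neg _
  have h2 := norm_le_of_gap (u := fun x => Q (-x)) (hm.comp measurable_neg)
    ((Lp.memLp Q).comp_measurePreserving hneg) (a := a) (b := b) (R := R) ?_ ha hab ?_
  · have h3 := hneg.quasiMeasurePreserving.ae h2
    filter_upwards [h1, h3] with x hx hx' hxR
    rcases lt_abs.1 hxR with h | h
    · exact hx h
    · simpa using hx' h
  · refine hD.congr fun s => ?_
    congr 1
    have := integral_add_right_eq_self (μ := volume) (fun x => ‖Q x - Q (x + -s)‖ ^ 2) s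
    calc _ = ∫ x, ‖Q x - Q (x + -s)‖ ^ 2 := by rw [← this]; simp
      _ = ∫ x, ‖Q (-x) - Q (-x + -s)‖ ^ 2 :=
        (integral_neg_eq_self (fun x => ‖Q x - Q (x + -s)‖ ^ 2) volume).symm
      _ = _ := by
        refine integral_congr_ae (ae_of_all _ fun x => ?_)
        simp only
        rw [norm_sub_rev, neg_add]
  · have := hneg.quasiMeasurePreserving.ae hgap
    refine this.mono fun x hx h => hx ?_
    rw [abs_neg]
    exact h.trans_le (le_abs_self x)

/-! ### The Pohozaev identity and the case `ω ≤ 0` -/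

theorem integrable_norm_pow_five {f : ℝ → ℂ} (h2 : MemLp f 2) (h8 : MemLp f 8) :
    Integrable fun x => ‖f x‖ ^ 5 := by
  have hi8 : Integrable fun x => ‖f x‖ ^ 8 := by
    have := h8.integrable_norm_pow (p := 8) (by norm_num)
    exact_mod_cast this
  refine ((integrable_norm_sq h2).add hi8).mono' (h2.1.norm.pow 5) (ae_of_all _ fun x => ?_)
  have h0 := norm_nonneg (f x)
  rw [Real.norm_of_nonneg (by positivity), Pi.add_apply]
  rcases le_total ‖f x‖ 1 with h | h
  · have := pow_le_pow_of_le_one h0 h (show 2 ≤ 5 by norm_num)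
    have : 0 ≤ ‖f x‖ ^ 8 := by positivity
    linarith
  · have := pow_le_pow_right₀ h (show 5 ≤ 8 by norm_num)
    have : 0 ≤ ‖f x‖ ^ 2 := by positivity
    linarith

/-- The tangent inequality for the convex function `|z|⁵/5 + c|z|²/2`. With `α = |a|` and `β = |b|`
it reduces to the factorization `α⁵ - 5αβ⁴ + 4β⁵ = (α - β)² (α³ + 2α²β + 3αβ² + 4β³)`; convexity of
the quadratic term needs `0 ≤ c`. -/
theorem re_conj_sub_mul_le (a b : ℂ) {c : ℝ} (hc : 0 ≤ c) :
    (conj (a - b) * (((‖b‖ ^ 3 + c : ℝ) : ℂ) * b)).re ≤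
      (‖a‖ ^ 5 / 5 + c / 2 * ‖a‖ ^ 2) - (‖b‖ ^ 5 / 5 + c / 2 * ‖b‖ ^ 2) := by
  have h1 : (conj (a - b) * (((‖b‖ ^ 3 + c : ℝ) : ℂ) * b)).re =
      (‖b‖ ^ 3 + c) * ((conj a * b).re - ‖b‖ ^ 2) := by
    have : conj (a - b) * (((‖b‖ ^ 3 + c : ℝ) : ℂ) * b) =
        ((‖b‖ ^ 3 + c : ℝ) : ℂ) * (conj a * b - ((‖b‖ ^ 2 : ℝ) : ℂ)) := by
      have hb : ((‖b‖ ^ 2 : ℝ) : ℂ) = conj b * b := by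
        rw [Complex.conj_mul']; push_cast; rfl
      rw [hb, map_sub]; ring
    rw [this, Complex.re_ofReal_mul, Complex.sub_re, Complex.ofReal_re]
  have h2 : (conj a * b).re ≤ ‖a‖ * ‖b‖ := by
    refine (Complex.re_le_norm _).trans (le_of_eq ?_)
    rw [norm_mul, RCLike.norm_conj]
  rw [h1]
  have ha := norm_nonneg a
  have hb := norm_nonneg b
  set α := ‖a‖
  set β := ‖b‖
  have h3 : (β ^ 3 + c) * ((conj a * b).re - β ^ 2) ≤ (β ^ 3 + c) * (α * β - β ^ 2) := by
    gcongr
  refine h3.trans ?_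
  have h4 : 0 ≤ (α - β) ^ 2 * (α ^ 3 + 2 * α ^ 2 * β + 3 * α * β ^ 2 + 4 * β ^ 3) := by positivity
  have h5 : 0 ≤ c * (α - β) ^ 2 := by positivity
  nlinarith

/-- The weight `1 + sin (2πkx)` is nonnegative. It makes a pointwise inequality usable at the
frequency `k`. -/
theorem re_integral_add_im_integral_char_nonneg {d : ℝ → ℝ} (hd : Integrable d)
    (h0 : ∀ᵐ x, 0 ≤ d x) (k : ℝ) :
    0 ≤ (∫ x, (d x : ℂ)).re + (∫ x, (d x : ℂ) * char (k * x)).im := by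
  have hc : Continuous fun x : ℝ => char (k * x) :=
    continuous_char.comp (continuous_const.mul continuous_id)
  have hi : Integrable fun x => (d x : ℂ) * char (k * x) := by
    have hdc : Integrable fun x => (d x : ℂ) := hd.ofReal
    refine hdc.mono (hdc.1.mul hc.aestronglyMeasurable) (ae_of_all _ fun x => ?_)
    rw [norm_mul, norm_char, mul_one]
  have h1 : (∫ x, (d x : ℂ)).re = ∫ x, d x := by
    rw [integral_complex_ofReal, Complex.ofReal_re]
  have h2 : (∫ x, (d x : ℂ) * char (k * x)).im = ∫ x, d x * (char (k * x)).im := by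
    have := integral_im hi
    simpa using! this.symm
  have hi2 : Integrable fun x => d x * (char (k * x)).im := by
    have := hi.im
    simpa using! this
  rw [h1, h2, ← integral_add hd hi2]
  refine integral_nonneg_of_ae ?_
  filter_upwards [h0] with x hx
  have h3 := neg_le_of_abs_le ((Complex.abs_im_le_norm (char (k * x))).trans_eq (norm_char _))
  change 0 ≤ d x + d x * (char (k * x)).im
  nlinarith

/-! ### Difference quotients and the commutator bound -/

theorem tendsto_char_sub_one_div (y : ℝ) :
    Tendsto (fun s : ℝ => (char (s * y) - 1) / s) (𝓝[>] 0)
      (𝓝 (((2 * Real.pi * y : ℝ) : ℂ) * Complex.I)) := by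
  have h : HasDerivAt (fun s : ℝ => char (s * y)) (((2 * Real.pi * y : ℝ) : ℂ) * Complex.I) 0 := by
    have h1 : HasDerivAt (fun s : ℝ => ((2 * Real.pi * (s * y) : ℝ) : ℂ) * Complex.I)
        (((2 * Real.pi * y : ℝ) : ℂ) * Complex.I) 0 := by
      have h2 : HasDerivAt (fun s : ℝ => 2 * Real.pi * (s * y)) (2 * Real.pi * y) 0 := by
        simpa using ((hasDerivAt_id (0 : ℝ)).mul_const y).const_mul (2 * Real.pi)
      exact h2.ofReal_comp.mul_const _
    simpa [char] using! h1.cexp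
  have h2 := (hasDerivAt_iff_tendsto_slope_zero.1 h).mono_left
    (nhdsWithin_mono (0 : ℝ) (show Set.Ioi (0 : ℝ) ⊆ {0}ᶜ from fun s hs => ne_of_gt hs))
  refine h2.congr fun s => ?_
  simp [char_zero, div_eq_inv_mul]

/-- This makes the pairing of `Q'` with `G` converge absolutely: where `symb l ≠ 0` one has `l < 0`,
so `l + k` is either negative, and controlled by `symb (l + k)`, or between `0` and `|k|`. A full
derivative of `Q` is thus only needed on negative frequencies, where `symb * 𝓕 Q ∈ L²` provides it.
-/
theorem abs_add_mul_symb_le (l k : ℝ) : |l + k| * symb l ≤ (symb (l + k) + |k|) * symb l := by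
  rcases le_total 0 l with hl | hl
  · rw [symb_of_nonneg hl]; simp
  · refine mul_le_mul_of_nonneg_right ?_ (symb_nonneg l)
    have hk := le_abs_self k
    rcases le_total 0 (l + k) with h | h
    · rw [abs_of_nonneg h]
      linarith [symb_nonneg (l + k)]
    · rw [abs_of_nonpos h, symb_of_nonpos h]
      nlinarith [abs_nonneg k, Real.pi_gt_three]

section

variable {q : ℝ → ℂ}

theorem integrable_abs_add_mul_symb (hq : MemLp q 2)
    (hp : MemLp (fun l => (symb l : ℂ) * q l) 2) (k : ℝ) :
    Integrable fun l => |l + k| * ‖q (l + k)‖ * (symb l * ‖q l‖) := by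
  have h1 := (integrable_conj_mul (hp.comp_add_right k) hp).norm
  have h2 := ((integrable_conj_mul (hq.comp_add_right k) hp).norm).const_mul |k|
  refine (h1.add h2).mono' ?_ (ae_of_all _ fun l => ?_)
  · exact (((continuous_id.add continuous_const).abs).aestronglyMeasurable.mul
      (hq.comp_add_right k).1.norm).mul (continuous_symb.aestronglyMeasurable.mul hq.1.norm)
  · have h := mul_le_mul_of_nonneg_right (abs_add_mul_symb_le l k)
      (by positivity : 0 ≤ ‖q (l + k)‖ * ‖q l‖)
    have s1 := symb_nonneg l
    have s2 := symb_nonneg (l + k)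
    rw [Real.norm_of_nonneg (by positivity), Pi.add_apply]
    simp only [norm_mul, RCLike.norm_conj, Complex.norm_real, Real.norm_of_nonneg s1,
      Real.norm_of_nonneg s2]
    linarith

theorem tendsto_integral_char_sub_one_div (hq : MemLp q 2)
    (hp : MemLp (fun l => (symb l : ℂ) * q l) 2) (k : ℝ) :
    Tendsto (fun s : ℝ =>
      (∫ l, conj ((char (s * (l + k)) - 1) * q (l + k)) * ((symb l : ℂ) * q l)) / s) (𝓝[>] 0)
      (𝓝 (∫ l, conj ((((2 * Real.pi * (l + k) : ℝ) : ℂ) * Complex.I) * q (l + k)) *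
        ((symb l : ℂ) * q l))) := by
  simp only [← integral_div]
  refine tendsto_integral_filter_of_dominated_convergence
    (fun l => 2 * Real.pi * (|l + k| * ‖q (l + k)‖ * (symb l * ‖q l‖))) ?_ ?_
    ((integrable_abs_add_mul_symb hq hp k).const_mul _) ?_
  · refine Eventually.of_forall fun s => ?_
    have hc : Continuous fun l : ℝ => char (s * (l + k)) - 1 :=
      (continuous_char.comp (continuous_const.mul (continuous_id.add continuous_const))).sub
        continuous_const
    exact ((Complex.continuous_conj.comp_aestronglyMeasurable
      (hc.aestronglyMeasurable.mul (hq.comp_add_right k).1)).mul hp.1).div₀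
        aestronglyMeasurable_const
  · filter_upwards [self_mem_nhdsWithin] with s hs
    have hs : 0 < s := hs
    refine ae_of_all _ fun l => ?_
    have s1 := symb_nonneg l
    have h := norm_char_sub_one_le (s * (l + k))
    rw [abs_mul, abs_of_pos hs] at h
    rw [norm_div, norm_mul, RCLike.norm_conj, norm_mul, norm_mul, Complex.norm_real,
      Complex.norm_real, Real.norm_of_nonneg s1, Real.norm_of_nonneg hs.le, div_le_iff₀ hs]
    have := mul_le_mul_of_nonneg_right h (by positivity : 0 ≤ ‖q (l + k)‖ * (symb l * ‖q l‖))
    linarith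
  · refine ae_of_all _ fun l => ?_
    have h1 := (Complex.continuous_conj.tendsto _).comp (tendsto_char_sub_one_div (l + k))
    have h2 := (h1.mul_const (conj (q (l + k)))).mul_const ((symb l : ℂ) * q l)
    rw [map_mul conj _ (q (l + k))]
    refine h2.congr fun s => ?_
    simp only [Function.comp, map_div₀, map_mul, Complex.conj_ofReal]
    ring

/-- Because `symb` is linear on each half-line, the expression vanishes unless `l` and `l + k` lie
on opposite sides of `0`; then both are at most `k` in absolute value. -/
theorem abs_add_mul_symb_sub_le (l : ℝ) {k : ℝ} (hk : 0 ≤ k) :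
    |(l + k) * symb l - l * symb (l + k)| ≤ 4 * Real.pi * k ^ 2 := by
  have hpi := Real.pi_pos
  rcases le_total 0 l with hl | hl
  · rw [symb_of_nonneg hl, symb_of_nonneg (by linarith)]
    simp only [mul_zero, sub_zero, abs_zero]; positivity
  · rcases le_total 0 (l + k) with h | h
    · rw [symb_of_nonneg h, symb_of_nonpos hl, abs_of_nonneg]
      · have h1 : -l * (l + k) ≤ k * k := mul_le_mul (by linarith) (by linarith) h hk
        nlinarith
      · have h1 : 0 ≤ -l * (l + k) := mul_nonneg (by linarith) h
        nlinarith
    · rw [symb_of_nonpos h, symb_of_nonpos hl]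
      have : (l + k) * -(4 * Real.pi * l) - l * -(4 * Real.pi * (l + k)) = 0 := by ring
      rw [this, abs_zero]; positivity

/-- Shifting the second integral by `k` puts both on the same product `conj (q (l + k)) * q l`, and
their multipliers combine into the commutator of `abs_add_mul_symb_sub_le`. -/
theorem norm_add_conj_le (hq : MemLp q 2) (hp : MemLp (fun l => (symb l : ℂ) * q l) 2)
    {k : ℝ} (hk : 0 ≤ k) :
    ‖(∫ l, conj ((((2 * Real.pi * (l + k) : ℝ) : ℂ) * Complex.I) * q (l + k)) *
        ((symb l : ℂ) * q l)) +
      conj (∫ l, conj ((((2 * Real.pi * (l + -k) : ℝ) : ℂ) * Complex.I) * q (l + -k)) *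
        ((symb l : ℂ) * q l))‖ ≤ 8 * Real.pi ^ 2 * k ^ 2 * ∫ l, ‖q l‖ ^ 2 := by
  have hint : ∀ k : ℝ, Integrable fun l =>
      conj ((((2 * Real.pi * (l + k) : ℝ) : ℂ) * Complex.I) * q (l + k)) *
        ((symb l : ℂ) * q l) := by
    intro k
    refine ((integrable_abs_add_mul_symb hq hp k).const_mul (2 * Real.pi)).mono' ?_
      (ae_of_all _ fun l => ?_)
    · have hc : Continuous fun l : ℝ => ((2 * Real.pi * (l + k) : ℝ) : ℂ) * Complex.I := by
        fun_prop
      exact (Complex.continuous_conj.comp_aestronglyMeasurable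
        (hc.aestronglyMeasurable.mul (hq.comp_add_right k).1)).mul hp.1
    · rw [norm_mul, RCLike.norm_conj, norm_mul, norm_mul, norm_mul, Complex.norm_real,
        Complex.norm_real, Complex.norm_I, Real.norm_of_nonneg (symb_nonneg l), Real.norm_eq_abs,
        abs_mul, abs_of_pos Real.two_pi_pos]
      exact le_of_eq (by ring)
  have hshift := integral_add_right_eq_self (μ := volume) (fun l =>
    conj (conj ((((2 * Real.pi * (l + -k) : ℝ) : ℂ) * Complex.I) * q (l + -k)) *
      ((symb l : ℂ) * q l))) k
  have hint2 : Integrable fun l =>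
      conj (conj ((((2 * Real.pi * (l + k + -k) : ℝ) : ℂ) * Complex.I) * q (l + k + -k)) *
        ((symb (l + k) : ℂ) * q (l + k))) :=
    (Complex.conjCLE.toContinuousLinearMap.integrable_comp (hint (-k))).comp_add_right k
  rw [← integral_conj, ← hshift, ← integral_add (hint k) hint2]
  have hsq : ∫ l, ‖q (l + k)‖ ^ 2 = ∫ l, ‖q l‖ ^ 2 :=
    integral_add_right_eq_self (fun l => ‖q l‖ ^ 2) k
  have i1 := integrable_norm_sq hq
  have i2 := integrable_norm_sq (hq.comp_add_right k)
  calc _ ≤ ∫ l, 8 * Real.pi ^ 2 * k ^ 2 * ((‖q (l + k)‖ ^ 2 + ‖q l‖ ^ 2) / 2) := by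
        refine norm_integral_le_of_norm_le (((i2.add i1).div_const 2).const_mul _)
          (ae_of_all _ fun l => ?_)
        have hid : conj ((((2 * Real.pi * (l + k) : ℝ) : ℂ) * Complex.I) * q (l + k)) *
              ((symb l : ℂ) * q l) +
            conj (conj ((((2 * Real.pi * (l + k + -k) : ℝ) : ℂ) * Complex.I) * q (l + k + -k)) *
              ((symb (l + k) : ℂ) * q (l + k))) =
            (((l + k) * symb l - l * symb (l + k) : ℝ) : ℂ) *
              (-(2 * Real.pi) * Complex.I * (conj (q (l + k)) * q l)) := by
          rw [add_neg_cancel_right]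
          simp only [map_mul, map_neg, Complex.conj_conj, Complex.conj_ofReal, Complex.conj_I]
          push_cast
          ring
        refine (congrArg norm hid).trans_le ?_
        have h := abs_add_mul_symb_sub_le l hk
        have h2 : ‖-(2 * (Real.pi : ℂ)) * Complex.I * (conj (q (l + k)) * q l)‖ =
            2 * Real.pi * (‖q (l + k)‖ * ‖q l‖) := by
          rw [norm_mul, norm_mul, norm_neg, norm_mul, norm_mul, RCLike.norm_conj, Complex.norm_I,
            Complex.norm_real, Real.norm_of_nonneg Real.pi_pos.le]
          simp
        rw [norm_mul, Complex.norm_real, Real.norm_eq_abs, h2]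
        have h3 := two_mul_le_add_sq ‖q (l + k)‖ ‖q l‖
        have hpi := Real.pi_pos
        calc _ ≤ 4 * Real.pi * k ^ 2 *
              (2 * Real.pi * ((‖q (l + k)‖ ^ 2 + ‖q l‖ ^ 2) / 2)) := by
              gcongr; linarith
          _ = _ := by ring
    _ = _ := by
        rw [integral_const_mul, integral_div, integral_add i2 i1, hsq]
        ring

end

theorem integrable_mul_char {f : ℝ → ℂ} (hf : Integrable f) (k : ℝ) :
    Integrable fun x => f x * char (k * x) := by
  refine hf.mono (hf.1.mul (continuous_char.comp
    (continuous_const.mul continuous_id)).aestronglyMeasurable) (ae_of_all _ fun x => ?_)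
  rw [norm_mul, norm_char, mul_one]

theorem fourierInv_eq_integral_char (f : ℝ → ℂ) (k : ℝ) :
    𝓕⁻ f k = ∫ x, f x * char (k * x) := by
  rw [Real.fourierInv_eq]
  refine integral_congr_ae (ae_of_all _ fun x => ?_)
  simp only [Circle.smul_def, coe_fourierChar, smul_eq_mul]
  rw [mul_comm]
  rfl

theorem continuous_integral_mul_char {f : ℝ → ℂ} (hf : Integrable f) :
    Continuous fun k : ℝ => ∫ x, f x * char (k * x) := by
  rw [show (fun k : ℝ => ∫ x, f x * char (k * x)) = 𝓕⁻ f from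
    funext fun k => (fourierInv_eq_integral_char f k).symm]
  exact continuous_fourierInv_of_integrable hf

theorem integral_comp_add_right_mul_char (f : ℝ → ℂ) (s k : ℝ) :
    ∫ x, f (x + s) * char (k * x) = char (-(k * s)) * ∫ x, f x * char (k * x) := by
  rw [← integral_const_mul,
    ← integral_add_right_eq_self (fun x => char (-(k * s)) * (f x * char (k * x))) s]
  refine integral_congr_ae (ae_of_all _ fun x => ?_)
  have h : char (k * x) = char (-(k * s)) * char (k * (x + s)) := by
    rw [← char_add]; ring_nf
  simp only [h]
  ring

/-- The local Pohozaev inequality on the Fourier side, for `ω = -c ≤ 0`. -/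
theorem re_integral_energy_mul_char_le {c : ℝ} (hc : 0 ≤ c) {Q G : L2R} (hQ8 : MemLp Q 8)
    (hG : G =ᵐ[volume] fun x => ((‖Q x‖ ^ 3 + c : ℝ) : ℂ) * Q x)
    (hF : (𝓕 G : L2R) =ᵐ[volume] fun l => (symb l : ℂ) * (𝓕 Q : L2R) l) {k : ℝ} (hk : 0 < k) :
    (∫ x, ((‖Q x‖ ^ 5 / 5 + c / 2 * ‖Q x‖ ^ 2 : ℝ) : ℂ) * char (k * x)).re ≤
      2 * Real.pi * (∫ l, ‖(𝓕 Q : L2R) l‖ ^ 2) * k := by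
  set q : ℝ → ℂ := ⇑(𝓕 Q : L2R) with hqdef
  have hq : MemLp q 2 := Lp.memLp _
  have hp : MemLp (fun l => (symb l : ℂ) * q l) 2 := (Lp.memLp (𝓕 G : L2R)).ae_eq hF
  set B : ℝ → ℝ := fun x => ‖Q x‖ ^ 5 / 5 + c / 2 * ‖Q x‖ ^ 2 with hB
  have hBi : Integrable B := ((integrable_norm_pow_five (Lp.memLp Q) hQ8).div_const 5).add
    ((integrable_norm_sq (Lp.memLp Q)).const_mul _)
  have hBc : Integrable fun x => (B x : ℂ) := hBi.ofReal
  set β := ∫ x, (B x : ℂ) * char (k * x) with hβ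
  set I : ℝ → ℝ → ℂ := fun j s =>
    ∫ l, conj ((char (s * (l + j)) - 1) * q (l + j)) * ((symb l : ℂ) * q l) with hI
  set L : ℝ → ℂ := fun j =>
    ∫ l, conj ((((2 * Real.pi * (l + j) : ℝ) : ℂ) * Complex.I) * q (l + j)) *
      ((symb l : ℂ) * q l) with hL
  have hIL : ∀ j, Tendsto (fun s => I j s / s) (𝓝[>] 0) (𝓝 (L j)) := fun j =>
    tendsto_integral_char_sub_one_div hq hp j
  -- the inequality before passing to the limit
  have hineq : ∀ s : ℝ, 0 ≤ -(I 0 s).re + ((char (s * -k) - 1) * β).im -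
      ((I k s + conj (I (-k) s)) / 2).im := by
    intro s
    set z : ℝ → ℂ := fun x => conj (Q (x + s) - Q x) * G x with hz
    have hzi : Integrable z := integrable_conj_mul (memLp_sub_translate Q s) (Lp.memLp G)
    set d : ℝ → ℝ := fun x => B (x + s) - B x - (z x).re with hd
    have hdi : Integrable d := ((hBi.comp_add_right s).sub hBi).sub hzi.re
    have hd0 : ∀ᵐ x, 0 ≤ d x := by
      filter_upwards [hG] with x hx
      simp only [hd, hz, hx, hB]
      exact sub_nonneg.2 (re_conj_sub_mul_le _ _ hc)
    have hzI : ∀ j, ∫ x, z x * char (j * x) = I j s := by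
      intro j
      have h1 := (memLp_sub_translate Q s).coeFn_toLp
      have h2 := fourier_sub_translate h1
      set T : L2R := (memLp_sub_translate Q s).toLp _
      have h3 := integral_conj_mul_char_fourier T G j
      have h4 := (measurePreserving_add_right volume j).quasiMeasurePreserving.ae h2
      calc _ = ∫ x, conj (T x) * G x * char (j * x) := by
            refine integral_congr_ae ?_
            filter_upwards [h1] with x hx
            rw [hx]
        _ = _ := h3
        _ = _ := by
            refine integral_congr_ae ?_
            filter_upwards [h4, hF] with l h5 h6
            rw [h5, h6]
    -- Taking the real part of `z` symmetrizes its transform, which is why `I j` occurs together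
    -- with the conjugate of `I (-j)`.
    have hJ : ∀ j, ∫ x, (d x : ℂ) * char (j * x) =
        (char (s * -j) - 1) * (∫ x, (B x : ℂ) * char (j * x)) -
          (I j s + conj (I (-j) s)) / 2 := by
      intro j
      have e1 := integral_comp_add_right_mul_char (fun x => (B x : ℂ)) s j
      have e2 : ∫ x, ((z x).re : ℂ) * char (j * x) = (I j s + conj (I (-j) s)) / 2 := by
        have hzc : Integrable fun x => conj (z x * char (-j * x)) :=
          Complex.conjCLE.toContinuousLinearMap.integrable_comp (integrable_mul_char hzi (-j))
        rw [← hzI, ← hzI, ← integral_conj, ← integral_add (integrable_mul_char hzi j) hzc,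
          ← integral_div]
        refine integral_congr_ae (ae_of_all _ fun x => ?_)
        simp only
        rw [map_mul, conj_char, neg_mul, neg_neg, ← add_mul, Complex.add_conj]
        push_cast; ring
      have i1 : Integrable fun x => (B (x + s) : ℂ) * char (j * x) :=
        integrable_mul_char (hBc.comp_add_right s) j
      have i2 := integrable_mul_char hBc j
      have hzre : Integrable fun x => ((z x).re : ℂ) := hzi.re.ofReal
      have i3 := integrable_mul_char hzre j
      rw [← e2, sub_mul, one_mul, show s * -j = -(j * s) by ring, ← e1,
        ← integral_sub i1 i2]
      refine Eq.trans ?_ (integral_sub (i1.sub i2) i3)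
      refine integral_congr_ae (ae_of_all _ fun x => ?_)
      simp only [hd]
      push_cast; ring
    have h := re_integral_add_im_integral_char_nonneg hdi hd0 k
    have h0 := hJ 0
    simp only [zero_mul, char_zero, mul_one, neg_zero, mul_zero, sub_self, zero_sub] at h0
    rw [h0, hJ k, Complex.add_conj] at h
    rw [Complex.sub_im] at h
    have e : (-(((2 * (I 0 s).re : ℝ) : ℂ) / 2)).re = -(I 0 s).re := by
      rw [← Complex.ofReal_ofNat, ← Complex.ofReal_div, ← Complex.ofReal_neg, Complex.ofReal_re]
      ring
    rw [e] at h
    linarith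
  have hlim : Tendsto (fun s : ℝ => -(I 0 s / s).re + ((char (s * -k) - 1) / s * β).im -
      ((I k s / s + conj (I (-k) s / s)) / 2).im) (𝓝[>] 0)
      (𝓝 (-(L 0).re + ((((2 * Real.pi * -k : ℝ) : ℂ) * Complex.I) * β).im -
        ((L k + conj (L (-k))) / 2).im)) := by
    have t1 := (Complex.continuous_re.tendsto _).comp (hIL 0)
    have t2 := (Complex.continuous_im.tendsto _).comp
      ((tendsto_char_sub_one_div (-k)).mul_const β)
    have t3 := (Complex.continuous_conj.tendsto _).comp (hIL (-k))
    have t4 := (Complex.continuous_im.tendsto _).comp (((hIL k).add t3).div_const 2)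
    exact (t1.neg.add t2).sub t4
  have hnn : 0 ≤ -(L 0).re + ((((2 * Real.pi * -k : ℝ) : ℂ) * Complex.I) * β).im -
        ((L k + conj (L (-k))) / 2).im := by
    refine ge_of_tendsto hlim ?_
    filter_upwards [self_mem_nhdsWithin] with s hs
    have hs : 0 < s := hs
    have h := div_nonneg (hineq s) hs.le
    refine h.trans (le_of_eq ?_)
    have e3 : (I k s / s + conj (I (-k) s / s)) / 2 = (I k s + conj (I (-k) s)) / 2 / s := by
      rw [map_div₀, Complex.conj_ofReal]; ring
    rw [e3, div_mul_eq_mul_div, Complex.div_ofReal_re, Complex.div_ofReal_im, Complex.div_ofReal_im]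
    ring
  -- The commutator bound at `k = 0`: the zero-frequency term has no first-order contribution.
  have hL0 : (L 0).re = 0 := by
    have h := norm_add_conj_le hq hp le_rfl
    rw [neg_zero] at h
    have h' : ‖L 0 + conj (L 0)‖ ≤ 0 := h.trans_eq (by ring)
    rw [norm_le_zero_iff, Complex.add_conj, Complex.ofReal_eq_zero] at h'
    linarith
  have hLk : -((L k + conj (L (-k))) / 2).im ≤ 4 * Real.pi ^ 2 * k ^ 2 * ∫ l, ‖q l‖ ^ 2 := by
    have h := norm_add_conj_le hq hp hk.le
    have h1 := (Complex.abs_im_le_norm (L k + conj (L (-k)))).trans h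
    have h2 := (abs_le.1 h1).1
    have e : ((L k + conj (L (-k))) / 2).im = (L k + conj (L (-k))).im / 2 := by
      rw [← Complex.ofReal_ofNat, Complex.div_ofReal_im]
    rw [e]
    linarith
  have hβe : ((((2 * Real.pi * -k : ℝ) : ℂ) * Complex.I) * β).im = -(2 * Real.pi * k * β.re) := by
    rw [mul_assoc, Complex.im_ofReal_mul, Complex.I_mul_im]; ring
  rw [hL0, hβe] at hnn
  have hpk : 0 < 2 * Real.pi * k := by positivity
  have hfin : 2 * Real.pi * k * β.re ≤ 2 * Real.pi * k * (2 * Real.pi * (∫ l, ‖q l‖ ^ 2) * k) := by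
    have : 2 * Real.pi * k * (2 * Real.pi * (∫ l, ‖q l‖ ^ 2) * k) =
      4 * Real.pi ^ 2 * k ^ 2 * ∫ l, ‖q l‖ ^ 2 := by ring
    linarith
  exact le_of_mul_le_mul_left hfin hpk

theorem eq_zero_of_nonneg {c : ℝ} (hc : 0 ≤ c) {Q G : L2R} (hQ8 : MemLp Q 8)
    (hG : G =ᵐ[volume] fun x => ((‖Q x‖ ^ 3 + c : ℝ) : ℂ) * Q x)
    (hF : (𝓕 G : L2R) =ᵐ[volume] fun l => (symb l : ℂ) * (𝓕 Q : L2R) l) :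
    ∀ᵐ x, Q x = 0 := by
  set B : ℝ → ℝ := fun x => ‖Q x‖ ^ 5 / 5 + c / 2 * ‖Q x‖ ^ 2 with hB
  have hBi : Integrable B := ((integrable_norm_pow_five (Lp.memLp Q) hQ8).div_const 5).add
    ((integrable_norm_sq (Lp.memLp Q)).const_mul _)
  have hBc : Integrable fun x => (B x : ℂ) := hBi.ofReal
  have h0 : 0 ≤ B := fun x => by simp only [hB]; positivity
  have hle : ∫ x, B x ≤ 0 := by
    have t1 : Tendsto (fun k : ℝ => (∫ x, (B x : ℂ) * char (k * x)).re) (𝓝[>] 0)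
        (𝓝 (∫ x, (B x : ℂ) * char (0 * x)).re) :=
      ((Complex.continuous_re.comp (continuous_integral_mul_char hBc)).tendsto 0).mono_left
        nhdsWithin_le_nhds
    have t2 : Tendsto (fun k : ℝ => 2 * Real.pi * (∫ l, ‖(𝓕 Q : L2R) l‖ ^ 2) * k) (𝓝[>] 0)
        (𝓝 (2 * Real.pi * (∫ l, ‖(𝓕 Q : L2R) l‖ ^ 2) * 0)) :=
      (tendsto_const_nhds.mul tendsto_id).mono_left nhdsWithin_le_nhds
    have h := le_of_tendsto_of_tendsto t1 t2 (by
      filter_upwards [self_mem_nhdsWithin] with k hk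
      exact re_integral_energy_mul_char_le hc hQ8 hG hF hk)
    simp only [zero_mul, char_zero, mul_one, mul_zero] at h
    rwa [integral_complex_ofReal, Complex.ofReal_re] at h
  have hz := (integral_eq_zero_iff_of_nonneg h0 hBi).1 (le_antisymm hle (integral_nonneg h0))
  filter_upwards [hz] with x hx
  have hx : ‖Q x‖ ^ 5 / 5 + c / 2 * ‖Q x‖ ^ 2 = 0 := hx
  have h1 : 0 ≤ c / 2 * ‖Q x‖ ^ 2 := by positivity
  have h2 : 0 ≤ ‖Q x‖ ^ 5 := by positivity
  have h3 : ‖Q x‖ ^ 5 = 0 := by linarith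
  exact norm_eq_zero.1 (pow_eq_zero_iff (by norm_num) |>.1 h3)

/-! ### A Hardy inequality: integrability of the Fourier transform of `conj G * Q` -/

/-- The two kernels of the Schur test for the operator `p ↦ ∫_l^0 p / |l|`. -/
noncomputable def schurKernel (a b : ℝ) (r l : ℝ) : ENNReal :=
  {z : ℝ × ℝ | z.2 < z.1 ∧ z.1 < 0}.indicator
    (fun z => ENNReal.ofReal ((-z.1) ^ a * (-z.2) ^ b)) (r, l)

theorem measurable_schurKernel (a b : ℝ) :
    Measurable fun z : ℝ × ℝ => schurKernel a b z.1 z.2 := by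
  refine Measurable.indicator (by fun_prop) ?_
  exact (measurableSet_lt measurable_snd measurable_fst).inter
    (measurableSet_lt measurable_fst measurable_const)

theorem schurKernel_of_lt {a b r l : ℝ} (h1 : l < r) (h2 : r < 0) :
    schurKernel a b r l = ENNReal.ofReal ((-r) ^ a * (-l) ^ b) :=
  Set.indicator_of_mem (show (r, l) ∈ {z : ℝ × ℝ | z.2 < z.1 ∧ z.1 < 0} from ⟨h1, h2⟩) _

theorem lintegral_schurKernel_left_le (r : ℝ) :
    ∫⁻ l, schurKernel (1 / 2) (-3 / 2) r l ≤ 2 := by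
  rcases le_or_gt 0 r with hr | hr
  · have : ∀ l, schurKernel (1 / 2) (-3 / 2) r l = 0 := fun l =>
      Set.indicator_of_notMem (fun h => not_lt.2 hr h.2) _
    simp only [this, lintegral_zero, zero_le]
  · have hr' : 0 < -r := by linarith
    calc ∫⁻ l, schurKernel (1 / 2) (-3 / 2) r l
        = ∫⁻ l, schurKernel (1 / 2) (-3 / 2) r (-l) := (lintegral_neg_eq_self _).symm
      _ = ∫⁻ l in Set.Ioi (-r), ENNReal.ofReal ((-r) ^ (1 / 2 : ℝ) * l ^ (-3 / 2 : ℝ)) := by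
        rw [← lintegral_indicator measurableSet_Ioi]
        refine lintegral_congr fun l => ?_
        by_cases hl : l ∈ Set.Ioi (-r)
        · have : -r < l := hl
          rw [Set.indicator_of_mem hl, schurKernel_of_lt (by linarith) hr, neg_neg]
        · have : ¬ -r < l := hl
          rw [Set.indicator_of_notMem hl]
          exact Set.indicator_of_notMem (fun h => this (by have := h.1; simp at this; linarith)) _
      _ = ENNReal.ofReal (∫ l in Set.Ioi (-r), (-r) ^ (1 / 2 : ℝ) * l ^ (-3 / 2 : ℝ)) := by
        rw [ofReal_integral_eq_lintegral_ofReal]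
        · exact (integrableOn_Ioi_rpow_of_lt (by norm_num) hr').const_mul _
        · filter_upwards [ae_restrict_mem measurableSet_Ioi] with l hl
          have : 0 < l := hr'.trans hl
          change 0 ≤ (-r) ^ (1 / 2 : ℝ) * l ^ (-3 / 2 : ℝ)
          positivity
      _ = ENNReal.ofReal 2 := by
        congr 1
        rw [integral_const_mul, integral_Ioi_rpow_of_lt (by norm_num) hr']
        have h : (-r) ^ (1 / 2 : ℝ) * (-r) ^ (-1 / 2 : ℝ) = 1 := by
          rw [← Real.rpow_add hr']; norm_num
        have e : (-3 / 2 + 1 : ℝ) = -1 / 2 := by norm_num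
        rw [e]
        linear_combination 2 * h
      _ ≤ 2 := by simp

theorem lintegral_schurKernel_right_le (l : ℝ) :
    ∫⁻ r, schurKernel (-1 / 2) (-1 / 2) r l ≤ 2 := by
  rcases le_or_gt 0 l with hl | hl
  · have : ∀ r, schurKernel (-1 / 2) (-1 / 2) r l = 0 := fun r =>
      Set.indicator_of_notMem (fun h => by have h1 := h.1; have h2 := h.2; simp at h1 h2; linarith) _
    simp only [this, lintegral_zero, zero_le]
  · have hl' : 0 < -l := by linarith
    calc ∫⁻ r, schurKernel (-1 / 2) (-1 / 2) r l
        = ∫⁻ r, schurKernel (-1 / 2) (-1 / 2) (-r) l := (lintegral_neg_eq_self _).symm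
      _ = ∫⁻ r in Set.Ioo 0 (-l), ENNReal.ofReal (r ^ (-1 / 2 : ℝ) * (-l) ^ (-1 / 2 : ℝ)) := by
        rw [← lintegral_indicator measurableSet_Ioo]
        refine lintegral_congr fun r => ?_
        by_cases hr : r ∈ Set.Ioo 0 (-l)
        · rw [Set.indicator_of_mem hr,
            schurKernel_of_lt (by linarith [hr.2]) (by linarith [hr.1]), neg_neg]
        · rw [Set.indicator_of_notMem hr]
          refine Set.indicator_of_notMem (fun h => hr ?_) _
          have h1 := h.1
          have h2 := h.2
          simp at h1 h2
          exact ⟨h2, by linarith⟩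
      _ = ENNReal.ofReal (∫ r in Set.Ioo 0 (-l), r ^ (-1 / 2 : ℝ) * (-l) ^ (-1 / 2 : ℝ)) := by
        rw [ofReal_integral_eq_lintegral_ofReal]
        · have := (intervalIntegral.intervalIntegrable_rpow' (a := 0) (b := -l)
            (r := -1 / 2) (by norm_num)).1
          exact (this.mono_set Set.Ioo_subset_Ioc_self).mul_const _
        · filter_upwards [ae_restrict_mem measurableSet_Ioo] with r hr
          have : 0 < r := hr.1
          change 0 ≤ r ^ (-1 / 2 : ℝ) * (-l) ^ (-1 / 2 : ℝ)
          positivity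
      _ = ENNReal.ofReal 2 := by
        congr 1
        rw [integral_mul_const, ← integral_Ioc_eq_integral_Ioo,
          ← intervalIntegral.integral_of_le hl'.le, integral_rpow (Or.inl (by norm_num))]
        have h : (-l) ^ (1 / 2 : ℝ) * (-l) ^ (-1 / 2 : ℝ) = 1 := by
          rw [← Real.rpow_add hl']; norm_num
        have e : (-1 / 2 + 1 : ℝ) = 1 / 2 := by norm_num
        rw [e, Real.zero_rpow (by norm_num)]
        linear_combination 2 * h
      _ ≤ 2 := by simp

/-- AM-GM with `|q l| ≤ |symb l * q l| / |l|` for `l < 0`. The product of the two kernels is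
`|l|⁻²`, and their powers are balanced so that each has a bounded integral in the variable absent
from its factor. -/
theorem enorm_symb_mul_le (q : ℝ → ℂ) {r l : ℝ} (h : l < r) :
    ‖(symb r : ℂ) * q r‖ₑ * ‖q l‖ₑ ≤
      schurKernel (1 / 2) (-3 / 2) r l * ‖(symb r : ℂ) * q r‖ₑ ^ 2 +
        schurKernel (-1 / 2) (-1 / 2) r l * ‖(symb l : ℂ) * q l‖ₑ ^ 2 := by
  rcases le_or_gt 0 r with hr | hr
  · rw [symb_of_nonneg hr]; simp
  · have hr' : 0 < -r := by linarith
    have hl' : 0 < -l := by linarith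
    rw [schurKernel_of_lt h hr, schurKernel_of_lt h hr]
    simp only [← ofReal_norm]
    rw [← ENNReal.ofReal_mul (norm_nonneg _), ← ENNReal.ofReal_pow (norm_nonneg _),
      ← ENNReal.ofReal_pow (norm_nonneg _), ← ENNReal.ofReal_mul (by positivity),
      ← ENNReal.ofReal_mul (by positivity), ← ENNReal.ofReal_add (by positivity) (by positivity)]
    refine ENNReal.ofReal_le_ofReal ?_
    set a := ‖(symb r : ℂ) * q r‖
    have ha : 0 ≤ a := norm_nonneg _
    have hb : ‖(symb l : ℂ) * q l‖ = 4 * Real.pi * (-l) * ‖q l‖ := by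
      rw [norm_mul, Complex.norm_real, Real.norm_of_nonneg (symb_nonneg l),
        symb_of_nonpos (by linarith)]
      ring
    rw [hb]
    set b := ‖q l‖
    have hb0 : 0 ≤ b := norm_nonneg _
    set x := (-r) ^ (1 / 4 : ℝ) with hx
    set y := (-l) ^ (1 / 4 : ℝ) with hy
    have hx0 : 0 < x := by positivity
    have hy0 : 0 < y := by positivity
    have e1 : (-r) ^ (1 / 2 : ℝ) = x ^ 2 := by
      rw [hx, ← Real.rpow_natCast, ← Real.rpow_mul hr'.le]; norm_num
    have e2 : (-l) ^ (-3 / 2 : ℝ) = (y ^ 6)⁻¹ := by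
      rw [hy, ← Real.rpow_natCast, ← Real.rpow_mul hl'.le, ← Real.rpow_neg hl'.le]; norm_num
    have e3 : (-r) ^ (-1 / 2 : ℝ) = (x ^ 2)⁻¹ := by
      rw [← e1, ← Real.rpow_neg hr'.le]; norm_num
    have e4 : (-l) ^ (-1 / 2 : ℝ) = (y ^ 2)⁻¹ := by
      rw [hy, ← Real.rpow_natCast, ← Real.rpow_mul hl'.le, ← Real.rpow_neg hl'.le]; norm_num
    have e5 : -l = y ^ 4 := by
      rw [hy, ← Real.rpow_natCast, ← Real.rpow_mul hl'.le]; norm_num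
    rw [e1, e2, e3, e4, e5]
    have hpi : 1 ≤ 4 * Real.pi := by linarith [Real.pi_gt_three]
    have key : a * b ≤ x ^ 2 * (y ^ 6)⁻¹ * a ^ 2 + (x ^ 2)⁻¹ * (y ^ 2)⁻¹ * (y ^ 4 * b) ^ 2 := by
      have h0 : 0 ≤ (x * (y ^ 3)⁻¹ * a - x⁻¹ * y⁻¹ * (y ^ 4 * b)) ^ 2 := sq_nonneg _
      have h1 : (x * (y ^ 3)⁻¹ * a - x⁻¹ * y⁻¹ * (y ^ 4 * b)) ^ 2 =
          x ^ 2 * (y ^ 6)⁻¹ * a ^ 2 + (x ^ 2)⁻¹ * (y ^ 2)⁻¹ * (y ^ 4 * b) ^ 2 - 2 * (a * b) := by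
        field_simp; ring
      have h2 : 0 ≤ a * b := by positivity
      linarith
    refine key.trans ?_
    gcongr
    exact le_mul_of_one_le_left (by positivity) hpi

/-- The Schur test: with `r = l + k` the double integral is bounded by one over pairs `l < r`, where
each kernel integrates to at most `2` and leaves the `L²` norm of `symb * q`. -/
theorem lintegral_Ioi_lintegral_symb_lt_top {q : ℝ → ℂ} (hm : Measurable q)
    (hp : MemLp (fun l => (symb l : ℂ) * q l) 2) :
    ∫⁻ k in Set.Ioi 0, ∫⁻ l, ‖(symb (l + k) : ℂ) * q (l + k)‖ₑ * ‖q l‖ₑ < ⊤ := by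
  set P : ℝ → ENNReal := fun l => ‖(symb l : ℂ) * q l‖ₑ ^ 2 with hP
  have hPm : Measurable P :=
    (((Complex.continuous_ofReal.comp continuous_symb).measurable.mul hm).enorm).pow_const 2
  have hPi : ∫⁻ l, P l < ⊤ := by
    have := lintegral_rpow_enorm_lt_top_of_eLpNorm_lt_top (by norm_num) (by norm_num) hp.2
    simpa [hP] using this
  set F : ℝ → ℝ → ENNReal := fun r l =>
    schurKernel (1 / 2) (-3 / 2) r l * P r + schurKernel (-1 / 2) (-1 / 2) r l * P l with hF
  have m1 : Measurable fun z : ℝ × ℝ => schurKernel (1 / 2) (-3 / 2) z.1 z.2 * P z.1 :=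
    (measurable_schurKernel _ _).mul (hPm.comp measurable_fst)
  have m2 : Measurable fun z : ℝ × ℝ => schurKernel (-1 / 2) (-1 / 2) z.1 z.2 * P z.2 :=
    (measurable_schurKernel _ _).mul (hPm.comp measurable_snd)
  have hFm : Measurable fun z : ℝ × ℝ => F z.1 z.2 := m1.add m2
  calc _ ≤ ∫⁻ k in Set.Ioi 0, ∫⁻ l, F (l + k) l := by
        refine setLIntegral_mono' measurableSet_Ioi fun k hk => lintegral_mono fun l => ?_
        have hk : 0 < k := hk
        exact enorm_symb_mul_le q (by linarith)
    _ ≤ ∫⁻ k, ∫⁻ l, F (l + k) l := setLIntegral_le_lintegral _ _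
    _ = ∫⁻ l, ∫⁻ k, F (l + k) l := by
        refine lintegral_lintegral_swap ?_
        exact (hFm.comp ((measurable_snd.add measurable_fst).prodMk measurable_snd)).aemeasurable
    _ = ∫⁻ l, ∫⁻ r, F r l := by
        refine lintegral_congr fun l => ?_
        exact lintegral_add_left_eq_self (fun r => F r l) l
    _ = (∫⁻ l, ∫⁻ r, schurKernel (1 / 2) (-3 / 2) r l * P r) +
          ∫⁻ l, ∫⁻ r, schurKernel (-1 / 2) (-1 / 2) r l * P l := by
        rw [← lintegral_add_left]
        · refine lintegral_congr fun l => ?_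
          exact lintegral_add_left (m1.comp (measurable_id.prodMk measurable_const)) _
        · exact m1.lintegral_prod_left'
    _ = (∫⁻ r, (∫⁻ l, schurKernel (1 / 2) (-3 / 2) r l) * P r) +
          ∫⁻ l, (∫⁻ r, schurKernel (-1 / 2) (-1 / 2) r l) * P l := by
        congr 1
        · rw [lintegral_lintegral_swap
            (f := fun l r => schurKernel (1 / 2) (-3 / 2) r l * P r)
            (m1.comp measurable_swap).aemeasurable]
          refine lintegral_congr fun r => ?_
          exact lintegral_mul_const _
            ((measurable_schurKernel _ _).comp (measurable_const.prodMk measurable_id))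
        · refine lintegral_congr fun l => ?_
          exact lintegral_mul_const _
            ((measurable_schurKernel _ _).comp (measurable_id.prodMk measurable_const))
    _ ≤ (∫⁻ r, 2 * P r) + ∫⁻ l, 2 * P l := by
        gcongr with r l
        · exact lintegral_schurKernel_left_le r
        · exact lintegral_schurKernel_right_le l
    _ < ⊤ := by
        rw [lintegral_const_mul _ hPm]
        exact ENNReal.add_lt_top.2 ⟨ENNReal.mul_lt_top (by simp) hPi,
          ENNReal.mul_lt_top (by simp) hPi⟩

/-! ### The case `ω > 0` -/

section

variable {ω : ℝ} {Q G : L2R}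

theorem conj_mul_ae_eq (hG : G =ᵐ[volume] fun x => ((‖Q x‖ ^ 3 - ω : ℝ) : ℂ) * Q x) :
    (fun x => conj (G x) * Q x) =ᵐ[volume]
      fun x => (((‖Q x‖ ^ 3 - ω) * ‖Q x‖ ^ 2 : ℝ) : ℂ) := by
  filter_upwards [hG] with x hx
  have hb : ((‖Q x‖ : ℂ)) ^ 2 = conj (Q x) * Q x := by rw [Complex.conj_mul']
  rw [hx, map_mul, Complex.conj_ofReal]
  push_cast
  rw [hb]; ring

theorem integrable_density (hG : G =ᵐ[volume] fun x => ((‖Q x‖ ^ 3 - ω : ℝ) : ℂ) * Q x) :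
    Integrable fun x => (‖Q x‖ ^ 3 - ω) * ‖Q x‖ ^ 2 := by
  have h := ((integrable_conj_mul (Lp.memLp G) (Lp.memLp Q)).congr (conj_mul_ae_eq hG)).re
  refine h.congr (ae_of_all _ fun x => ?_)
  exact Complex.ofReal_re _

theorem integral_density_mul_char
    (hG : G =ᵐ[volume] fun x => ((‖Q x‖ ^ 3 - ω : ℝ) : ℂ) * Q x)
    (hF : (𝓕 G : L2R) =ᵐ[volume] fun l => (symb l : ℂ) * (𝓕 Q : L2R) l) (k : ℝ) :
    ∫ x, (((‖Q x‖ ^ 3 - ω) * ‖Q x‖ ^ 2 : ℝ) : ℂ) * char (k * x) =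
      ∫ l, conj ((symb (l + k) : ℂ) * (𝓕 Q : L2R) (l + k)) * (𝓕 Q : L2R) l := by
  calc _ = ∫ x, conj (G x) * Q x * char (k * x) := by
        refine integral_congr_ae ?_
        filter_upwards [conj_mul_ae_eq hG] with x hx
        rw [hx]
    _ = _ := integral_conj_mul_char_fourier G Q k
    _ = _ := by
        refine integral_congr_ae ?_
        filter_upwards [(measurePreserving_add_right volume k).quasiMeasurePreserving.ae hF]
          with l hl
        rw [hl]

theorem integrable_of_integrableOn_Ioi {f : ℝ → ℂ} (hc : Continuous f)
    (hs : ∀ k, ‖f (-k)‖ = ‖f k‖) (h : IntegrableOn f (Set.Ioi 0)) : Integrable f := by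
  have h1 : IntegrableOn (fun k => f (-k)) (Set.Ioi 0) :=
    Integrable.mono h (hc.comp continuous_neg).aestronglyMeasurable
      (ae_of_all _ fun k => (hs k).le)
  have h2 : IntegrableOn f (Set.Iio 0) := by
    have := (Measure.measurePreserving_neg (volume : Measure ℝ)).integrableOn_comp_preimage
      (MeasurableEquiv.neg ℝ).measurableEmbedding (f := f) (s := Set.Iio 0)
    refine this.1 ?_
    have e : (Neg.neg : ℝ → ℝ) ⁻¹' Set.Iio 0 = Set.Ioi 0 := by ext; simp
    rw [e]
    exact h1
  rw [← integrableOn_univ, ← Set.Iic_union_Ioi (a := (0 : ℝ))]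
  exact ((integrableOn_Iic_iff_integrableOn_Iio (by simp)).2 h2).union h

/-- The Fourier transform of `conj G * Q` is integrable. -/
theorem integrable_fourierInv_density
    (hG : G =ᵐ[volume] fun x => ((‖Q x‖ ^ 3 - ω : ℝ) : ℂ) * Q x)
    (hF : (𝓕 G : L2R) =ᵐ[volume] fun l => (symb l : ℂ) * (𝓕 Q : L2R) l) :
    Integrable (𝓕⁻ fun x => (((‖Q x‖ ^ 3 - ω) * ‖Q x‖ ^ 2 : ℝ) : ℂ)) := by
  set A : ℝ → ℂ := fun x => (((‖Q x‖ ^ 3 - ω) * ‖Q x‖ ^ 2 : ℝ) : ℂ) with hA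
  have hAi : Integrable A := (integrable_density hG).ofReal
  have hc : Continuous (𝓕⁻ A) := continuous_fourierInv_of_integrable hAi
  have hp : MemLp (fun l => (symb l : ℂ) * (𝓕 Q : L2R) l) 2 :=
    (Lp.memLp (𝓕 G : L2R)).ae_eq hF
  have hpos : IntegrableOn (𝓕⁻ A) (Set.Ioi 0) := by
    refine ⟨hc.aestronglyMeasurable, lt_of_le_of_lt ?_ (lintegral_Ioi_lintegral_symb_lt_top
      (Lp.stronglyMeasurable (𝓕 Q : L2R)).measurable hp)⟩
    refine lintegral_mono fun k => ?_
    rw [fourierInv_eq_integral_char, integral_density_mul_char hG hF]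
    refine (enorm_integral_le_lintegral_enorm _).trans (lintegral_mono fun l => le_of_eq ?_)
    rw [enorm_mul, RCLike.enorm_conj]
  have hsymm : ∀ k, 𝓕⁻ A (-k) = conj (𝓕⁻ A k) := by
    intro k
    rw [fourierInv_eq_integral_char, fourierInv_eq_integral_char, ← integral_conj]
    refine integral_congr_ae (ae_of_all _ fun x => ?_)
    simp only [hA, map_mul, Complex.conj_ofReal, conj_char, neg_mul]
  exact integrable_of_integrableOn_Ioi hc (fun k => by rw [hsymm, RCLike.norm_conj]) hpos

/-- The density is almost everywhere the Fourier transform of an integrable function, so the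
Riemann-Lebesgue lemma applies. -/
theorem exists_abs_density_lt
    (hG : G =ᵐ[volume] fun x => ((‖Q x‖ ^ 3 - ω : ℝ) : ℂ) * Q x)
    (hF : (𝓕 G : L2R) =ᵐ[volume] fun l => (symb l : ℂ) * (𝓕 Q : L2R) l) {ε : ℝ} (hε : 0 < ε) :
    ∃ R : ℝ, ∀ᵐ x, R < |x| → |(‖Q x‖ ^ 3 - ω) * ‖Q x‖ ^ 2| < ε := by
  have hAi : Integrable fun x => (((‖Q x‖ ^ 3 - ω) * ‖Q x‖ ^ 2 : ℝ) : ℂ) :=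
    (integrable_density hG).ofReal
  have h1 := ae_eq_fourier_fourierInv hAi (integrable_fourierInv_density hG hF)
  have h2 := Real.zero_at_infty_fourier
    (𝓕⁻ fun x => (((‖Q x‖ ^ 3 - ω) * ‖Q x‖ ^ 2 : ℝ) : ℂ))
  have h3 := h2.norm.eventually (gt_mem_nhds (by simpa using hε))
  obtain ⟨K, hK, hKs⟩ := mem_cocompact.1 h3
  obtain ⟨R, hR⟩ := hK.isBounded.exists_norm_le
  refine ⟨R, ?_⟩
  filter_upwards [h1] with x hx hxR
  have hxK : x ∈ Kᶜ := fun h => not_le.2 hxR (hR x h)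
  have h4 : ‖𝓕 (𝓕⁻ fun x => (((‖Q x‖ ^ 3 - ω) * ‖Q x‖ ^ 2 : ℝ) : ℂ)) x‖ < ε := hKs hxK
  rw [← hx, Complex.norm_real, Real.norm_eq_abs] at h4
  exact h4

theorem exists_density_nonpos (hω : 0 < ω) (hQ : MemHHalf Q)
    (hG : G =ᵐ[volume] fun x => ((‖Q x‖ ^ 3 - ω : ℝ) : ℂ) * Q x)
    (hF : (𝓕 G : L2R) =ᵐ[volume] fun l => (symb l : ℂ) * (𝓕 Q : L2R) l) :
    ∃ R : ℝ, ∀ᵐ x, R < |x| → (‖Q x‖ ^ 3 - ω) * ‖Q x‖ ^ 2 ≤ 0 := by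
  have hcube : ∀ t : ℝ, 0 < t → (t ^ (1 / 3 : ℝ)) ^ 3 = t := fun t ht => by
    rw [← Real.rpow_natCast, ← Real.rpow_mul ht.le]; norm_num
  -- Any two thresholds with cubes strictly between `0` and `ω` would do. For `a ≤ |Q| ≤ b` the
  -- density is at most `-(ω / 2) a²`, which the choice of `ε` excludes near infinity.
  set a := (ω / 4) ^ (1 / 3 : ℝ) with ha
  set b := (ω / 2) ^ (1 / 3 : ℝ) with hb
  have ha3 : a ^ 3 = ω / 4 := hcube _ (by positivity)
  have hb3 : b ^ 3 = ω / 2 := hcube _ (by positivity)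
  have ha0 : 0 < a := by positivity
  have hb0 : 0 < b := by positivity
  have hab : a < b := Real.rpow_lt_rpow (by positivity) (by linarith) (by norm_num)
  obtain ⟨R, hR⟩ := exists_abs_density_lt hG hF (ε := ω / 2 * a ^ 2) (by positivity)
  refine ⟨R, ?_⟩
  have hgap : ∀ᵐ x, R < |x| → ‖Q x‖ ≤ a ∨ b ≤ ‖Q x‖ := by
    filter_upwards [hR] with x hx hxR
    by_contra! hcon
    obtain ⟨h1, h2⟩ := hcon
    have h3 : ‖Q x‖ ^ 3 ≤ ω / 2 := by
      rw [← hb3]; exact pow_le_pow_left₀ (norm_nonneg _) h2.le 3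
    have h4 : a ^ 2 ≤ ‖Q x‖ ^ 2 := pow_le_pow_left₀ ha0.le h1.le 2
    have h5 := (abs_lt.1 (hx hxR)).1
    nlinarith [sq_nonneg a]
  filter_upwards [norm_le_of_gap_abs hQ ha0.le hab hgap] with x hx hxR
  have h3 : ‖Q x‖ ^ 3 ≤ ω / 4 := by
    rw [← ha3]; exact pow_le_pow_left₀ (norm_nonneg _) (hx hxR) 3
  exact mul_nonpos_of_nonpos_of_nonneg (by linarith) (by positivity)

/-! ### The virial argument -/

theorem one_sub_re_char_le (t : ℝ) : 1 - (char t).re ≤ 2 * Real.pi ^ 2 * t ^ 2 := by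
  have h : (char t).re = Real.cos (2 * Real.pi * t) := Complex.exp_ofReal_mul_I_re _
  rw [h]
  have := Real.one_sub_sq_div_two_le_cos (x := 2 * Real.pi * t)
  nlinarith

theorem re_char_le_one (t : ℝ) : (char t).re ≤ 1 :=
  (Complex.re_le_norm _).trans_eq (norm_char t)

/-- A virial inequality: the mass of the negative frequencies is controlled by the spatial
moment of `conj G * Q`. -/
theorem integral_Iic_le_integral_density (hQ : MemHHalf Q)
    (hG : G =ᵐ[volume] fun x => ((‖Q x‖ ^ 3 - ω : ℝ) : ℂ) * Q x)
    (hF : (𝓕 G : L2R) =ᵐ[volume] fun l => (symb l : ℂ) * (𝓕 Q : L2R) l) {k : ℝ} (hk : 0 < k) :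
    2 * Real.pi * k * ∫ l in Set.Iic (-k), ‖(𝓕 Q : L2R) l‖ ^ 2 ≤
      ∫ x, (‖Q x‖ ^ 3 - ω) * ‖Q x‖ ^ 2 * (1 - (char (k * x)).re) := by
  set q : ℝ → ℂ := ⇑(𝓕 Q : L2R) with hq
  set a : ℝ → ℝ := fun x => (‖Q x‖ ^ 3 - ω) * ‖Q x‖ ^ 2 with ha
  have hai : Integrable a := integrable_density hG
  have hac : Integrable fun x => (a x : ℂ) := hai.ofReal
  have hq2 : MemLp q 2 := Lp.memLp _
  have hp : MemLp (fun l => (symb l : ℂ) * q l) 2 := (Lp.memLp (𝓕 G : L2R)).ae_eq hF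
  have hqi := integrable_norm_sq hq2
  have hsi : Integrable fun l => symb l * ‖q l‖ ^ 2 := by
    refine ((integrable_abs_mul_norm_fourier_sq hQ).const_mul (4 * Real.pi)).mono'
      (continuous_symb.aestronglyMeasurable.mul (hq2.1.norm.pow 2)) (ae_of_all _ fun l => ?_)
    rw [Real.norm_of_nonneg (mul_nonneg (symb_nonneg l) (by positivity)), ← mul_assoc]
    exact mul_le_mul_of_nonneg_right (symb_le l) (by positivity)
  have hmono : ∀ l, symb (l + k) ≤ symb l := fun l => by
    have h1 : |l + k| ≤ |l| + k := (abs_add_le l k).trans_eq (by rw [abs_of_pos hk])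
    exact mul_le_mul_of_nonneg_left (by linarith) Real.two_pi_pos.le
  have hsi' : Integrable fun l => symb (l + k) * ‖q l‖ ^ 2 := by
    refine hsi.mono' ((continuous_symb.comp
      (continuous_id.add continuous_const)).aestronglyMeasurable.mul (hq2.1.norm.pow 2))
      (ae_of_all _ fun l => ?_)
    rw [Real.norm_of_nonneg (mul_nonneg (symb_nonneg _) (by positivity))]
    exact mul_le_mul_of_nonneg_right (hmono l) (by positivity)
  have hα : ∀ j, ∫ x, a x * (char (j * x)).re =
      ∫ l, (conj ((symb (l + j) : ℂ) * q (l + j)) * q l).re := by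
    intro j
    have h1 := integral_re (integrable_mul_char hac j)
    have h2 := integral_re (integrable_conj_mul (hp.comp_add_right j) hq2)
    have h3 := congrArg Complex.re (integral_density_mul_char hG hF j)
    calc _ = ∫ x, RCLike.re ((a x : ℂ) * char (j * x)) := by
          refine integral_congr_ae (ae_of_all _ fun x => ?_)
          exact (Complex.re_ofReal_mul _ _).symm
      _ = _ := h1
      _ = _ := h3
      _ = _ := h2.symm
  have hα0 : ∫ x, a x = ∫ l, symb l * ‖q l‖ ^ 2 := by
    have h := hα 0
    simp only [zero_mul, char_zero, Complex.one_re, mul_one, add_zero] at h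
    rw [h]
    refine integral_congr_ae (ae_of_all _ fun l => ?_)
    simp only
    rw [map_mul, Complex.conj_ofReal, mul_assoc, Complex.re_ofReal_mul, Complex.conj_mul',
      ← Complex.ofReal_pow, Complex.ofReal_re]
  have hshift : ∫ l, symb (l + k) * ‖q (l + k)‖ ^ 2 = ∫ l, symb l * ‖q l‖ ^ 2 :=
    integral_add_right_eq_self (fun l => symb l * ‖q l‖ ^ 2) k
  -- AM-GM on `conj (q (l + k)) * q l`, keeping the weight `symb (l + k)`.
  have hαk : ∫ x, a x * (char (k * x)).re ≤
      ((∫ l, symb l * ‖q l‖ ^ 2) + ∫ l, symb (l + k) * ‖q l‖ ^ 2) / 2 := by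
    rw [hα k, ← hshift, ← integral_add (hsi.comp_add_right k) hsi', ← integral_div]
    refine integral_mono (integrable_conj_mul (hp.comp_add_right k) hq2).re
      (((hsi.comp_add_right k).add hsi').div_const 2) fun l => ?_
    change (conj ((symb (l + k) : ℂ) * q (l + k)) * q l).re ≤
      (symb (l + k) * ‖q (l + k)‖ ^ 2 + symb (l + k) * ‖q l‖ ^ 2) / 2
    rw [map_mul, Complex.conj_ofReal, mul_assoc, Complex.re_ofReal_mul]
    have h1 : (conj (q (l + k)) * q l).re ≤ ‖q (l + k)‖ * ‖q l‖ := by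
      refine (Complex.re_le_norm _).trans_eq ?_
      rw [norm_mul, RCLike.norm_conj]
    have h2 := two_mul_le_add_sq ‖q (l + k)‖ ‖q l‖
    have h3 := symb_nonneg (l + k)
    nlinarith
  have hi1 : Integrable fun x => a x * (char (k * x)).re := by
    refine (integrable_mul_char hac k).re.congr (ae_of_all _ fun x => ?_)
    exact Complex.re_ofReal_mul _ _
  have hdiff : ∫ x, a x * (1 - (char (k * x)).re) =
      (∫ x, a x) - ∫ x, a x * (char (k * x)).re := by
    rw [← integral_sub hai hi1]
    refine integral_congr_ae (ae_of_all _ fun x => ?_)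
    simp only; ring
  -- `symb` is nonincreasing, and it drops by exactly `4πk` from `l` to `l + k` when `l ≤ -k`.
  have hlow : 4 * Real.pi * k * ∫ l in Set.Iic (-k), ‖q l‖ ^ 2 ≤
      (∫ l, symb l * ‖q l‖ ^ 2) - ∫ l, symb (l + k) * ‖q l‖ ^ 2 := by
    rw [← integral_sub hsi hsi', ← integral_const_mul, ← integral_indicator measurableSet_Iic]
    refine integral_mono ((hqi.const_mul _).indicator measurableSet_Iic) (hsi.sub hsi')
      fun l => ?_
    change (Set.Iic (-k)).indicator (fun l => 4 * Real.pi * k * ‖q l‖ ^ 2) l ≤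
      symb l * ‖q l‖ ^ 2 - symb (l + k) * ‖q l‖ ^ 2
    rw [← sub_mul]
    by_cases hl : l ∈ Set.Iic (-k)
    · have hl' : l ≤ -k := hl
      rw [Set.indicator_of_mem hl, symb_of_nonpos (by linarith), symb_of_nonpos (by linarith)]
      exact le_of_eq (by ring)
    · rw [Set.indicator_of_notMem hl]
      exact mul_nonneg (sub_nonneg.2 (hmono l)) (by positivity)
  rw [hdiff, hα0]
  linarith

/-- The virial inequality is linear in `k` on the left. On the right only `|x| ≤ R` can contribute
positively, and there `1 - cos (2πkx)` is `O(k²R²)`. Dividing by `k` and letting `k → 0` removes the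
mass below every `-δ`. -/
theorem ae_fourier_eq_zero_of_neg (hω : 0 < ω) (hQ : MemHHalf Q)
    (hG : G =ᵐ[volume] fun x => ((‖Q x‖ ^ 3 - ω : ℝ) : ℂ) * Q x)
    (hF : (𝓕 G : L2R) =ᵐ[volume] fun l => (symb l : ℂ) * (𝓕 Q : L2R) l) :
    ∀ᵐ l : ℝ, l < 0 → (𝓕 Q : L2R) l = 0 := by
  set q : ℝ → ℂ := ⇑(𝓕 Q : L2R) with hq
  have hqi : Integrable fun l => ‖q l‖ ^ 2 := integrable_norm_sq (Lp.memLp _)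
  have hai := integrable_density hG
  obtain ⟨R, hR⟩ := exists_density_nonpos hω hQ hG hF
  set C := ∫ x, |(‖Q x‖ ^ 3 - ω) * ‖Q x‖ ^ 2| with hC
  have hub : ∀ k : ℝ, ∫ x, (‖Q x‖ ^ 3 - ω) * ‖Q x‖ ^ 2 * (1 - (char (k * x)).re) ≤
      2 * Real.pi ^ 2 * (k * R) ^ 2 * C := by
    intro k
    rw [hC, ← integral_const_mul]
    refine integral_mono_ae ?_ (hai.abs.const_mul _) ?_
    · have h1 := (integrable_mul_char hai.ofReal k).re
      refine (hai.sub h1).congr (ae_of_all _ fun x => ?_)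
      have := Complex.re_ofReal_mul ((‖Q x‖ ^ 3 - ω) * ‖Q x‖ ^ 2) (char (k * x))
      refine (congrArg (fun t => (‖Q x‖ ^ 3 - ω) * ‖Q x‖ ^ 2 - t) this).trans ?_
      ring
    · filter_upwards [hR] with x hx
      have h0 := re_char_le_one (k * x)
      have h1 := one_sub_re_char_le (k * x)
      set y := (‖Q x‖ ^ 3 - ω) * ‖Q x‖ ^ 2
      rcases lt_or_ge R |x| with h | h
      · refine (mul_nonpos_of_nonpos_of_nonneg (hx h) (by linarith)).trans (by positivity)
      · have hxR : x ^ 2 ≤ R ^ 2 := by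
          rw [← sq_abs x]; exact pow_le_pow_left₀ (abs_nonneg x) h 2
        have h2 : 1 - (char (k * x)).re ≤ 2 * Real.pi ^ 2 * (k * R) ^ 2 := by
          refine h1.trans ?_
          rw [mul_pow, mul_pow]
          gcongr
        calc y * (1 - (char (k * x)).re) ≤ |y| * (1 - (char (k * x)).re) :=
              mul_le_mul_of_nonneg_right (le_abs_self y) (by linarith)
          _ ≤ |y| * (2 * Real.pi ^ 2 * (k * R) ^ 2) :=
              mul_le_mul_of_nonneg_left h2 (abs_nonneg y)
          _ = _ := mul_comm _ _
  have hzero : ∀ δ : ℝ, 0 < δ → ∫ l in Set.Iic (-δ), ‖q l‖ ^ 2 = 0 := by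
    intro δ hδ
    refine le_antisymm ?_ (integral_nonneg fun l => by positivity)
    have hle : ∀ k : ℝ, 0 < k → k ≤ δ →
        ∫ l in Set.Iic (-δ), ‖q l‖ ^ 2 ≤ k * (Real.pi * R ^ 2 * C) := by
      intro k hk hkδ
      have h1 : ∫ l in Set.Iic (-δ), ‖q l‖ ^ 2 ≤ ∫ l in Set.Iic (-k), ‖q l‖ ^ 2 :=
        setIntegral_mono_set hqi.integrableOn (ae_of_all _ fun l => by positivity)
          (Set.Iic_subset_Iic.2 (by linarith)).eventuallyLE
      have h2 := (integral_Iic_le_integral_density hQ hG hF hk).trans (hub k)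
      have hpk : 0 < 2 * Real.pi * k := by positivity
      refine h1.trans (le_of_mul_le_mul_left (h2.trans (le_of_eq ?_)) hpk)
      ring
    have hlim : Tendsto (fun k : ℝ => k * (Real.pi * R ^ 2 * C)) (𝓝[>] 0) (𝓝 0) := by
      have : Tendsto (fun k : ℝ => k * (Real.pi * R ^ 2 * C)) (𝓝 0)
          (𝓝 (0 * (Real.pi * R ^ 2 * C))) := tendsto_id.mul_const _
      rw [zero_mul] at this
      exact this.mono_left nhdsWithin_le_nhds
    refine ge_of_tendsto hlim ?_
    filter_upwards [Ioc_mem_nhdsGT hδ] with k hk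
    exact hle k hk.1 hk.2
  have hae : ∀ n : ℕ, ∀ᵐ l : ℝ, l ≤ -(1 / ((n : ℝ) + 1)) → q l = 0 := by
    intro n
    have h1 := (setIntegral_eq_zero_iff_of_nonneg_ae (ae_of_all _ fun l => by positivity)
      hqi.integrableOn).1 (hzero (1 / ((n : ℝ) + 1)) (by positivity))
    have h2 := (ae_restrict_iff' measurableSet_Iic).1 h1
    filter_upwards [h2] with l hl hln
    have h3 : ‖q l‖ ^ 2 = 0 := hl hln
    exact norm_eq_zero.1 (pow_eq_zero_iff (by norm_num) |>.1 h3)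
  filter_upwards [ae_all_iff.2 hae] with l hl hl0
  obtain ⟨n, hn⟩ := exists_nat_one_div_lt (show 0 < -l by linarith)
  exact hl n (by linarith)

theorem eq_zero_of_pos (hω : 0 < ω) (hQ : MemHHalf Q)
    (hG : G =ᵐ[volume] fun x => ((‖Q x‖ ^ 3 - ω : ℝ) : ℂ) * Q x)
    (hF : (𝓕 G : L2R) =ᵐ[volume] fun l => (symb l : ℂ) * (𝓕 Q : L2R) l) :
    ∀ᵐ x, Q x = 0 := by
  have hFG : 𝓕 G = 0 := by
    refine Lp.ext ?_
    filter_upwards [hF, ae_fourier_eq_zero_of_neg hω hQ hG hF, Lp.coeFn_zero ℂ 2 volume]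
      with l h1 h2 h3
    rw [h1, h3, Pi.zero_apply]
    rcases le_or_gt 0 l with h | h
    · rw [symb_of_nonneg h, Complex.ofReal_zero, zero_mul]
    · rw [h2 h, mul_zero]
  have hG0 : G = 0 := by
    have := Lp.norm_fourier_eq G
    rw [hFG, norm_zero] at this
    exact norm_eq_zero.1 this.symm
  have hω3 : (ω ^ (1 / 3 : ℝ)) ^ 3 = ω := by
    rw [← Real.rpow_natCast, ← Real.rpow_mul hω.le]; norm_num
  have hb : 0 < ω ^ (1 / 3 : ℝ) := by positivity
  -- With `R = -1` the condition `R < |x|` always holds, so the gap statement covers the whole line.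
  have hgap : ∀ᵐ x : ℝ, -1 < |x| → ‖Q x‖ ≤ 0 ∨ ω ^ (1 / 3 : ℝ) ≤ ‖Q x‖ := by
    filter_upwards [hG, Lp.coeFn_zero ℂ 2 volume] with x h1 h2 _
    rw [hG0, h2, Pi.zero_apply, eq_comm, mul_eq_zero, Complex.ofReal_eq_zero] at h1
    rcases h1 with h | h
    · right
      refine le_of_pow_le_pow_left₀ (n := 3) (by norm_num) (norm_nonneg _) ?_
      rw [hω3]; linarith
    · left; rw [h, norm_zero]
  filter_upwards [norm_le_of_gap_abs hQ le_rfl hb hgap] with x hx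
  exact norm_le_zero_iff.1 (hx (by linarith [abs_nonneg x]))

end

/-- There is no nontrivial `H^{1/2}` solution of the profile equation: a travelling wave of the
half-wave equation at unit speed vanishes identically. With `G = (|Q|³ - ω) Q`, the equation says
that `𝓕 G = symb * 𝓕 Q`, so `G` has negative frequencies only. For `ω ≤ 0` the Pohozaev identity
gives `∫ |Q|⁵ / 5 - ω |Q|² / 2 = 0`. For `ω > 0` the density `conj G * Q = (|Q|³ - ω) |Q|²` is
nonpositive near infinity, and the virial inequality shows that `Q` has no negative frequencies;
then `G = 0`, so that `|Q|` takes only the values `0` and `ω^{1/3}`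
and, not being able to jump between them, vanishes. -/
theorem ae_eq_zero_of_solvesProfileEquation {ω : ℝ} {Q : L2R} (hQ : MemHHalf Q)
    (heq : SolvesProfileEquation ω Q) : ∀ᵐ x, Q x = 0 := by
  have hQ8 := memLp_eight hQ
  have hmem : MemLp (fun x => ((‖Q x‖ ^ 3 - ω : ℝ) : ℂ) * Q x) 2 := by
    refine ((memLp_norm_pow_three_mul hQ8).sub ((Lp.memLp Q).const_mul (ω : ℂ))).ae_eq
      (ae_of_all _ fun x => ?_)
    simp only [Pi.sub_apply]
    push_cast; ring
  have hG := hmem.coeFn_toLp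
  have hF := fourier_eq_symb_mul hQ heq hG
  rcases lt_or_ge 0 ω with hω | hω
  · exact eq_zero_of_pos hω hQ hG hF
  · refine eq_zero_of_nonneg (c := -ω) (by linarith) hQ8 ?_ hF
    simpa only [sub_eq_add_neg] using hG

theorem mainTheorem3 (ω : ℝ) (Q : Lp ℂ 2 (volume : Measure ℝ)) (hQ : MemHHalf Q)
    (heq : SolvesProfileEquation ω Q) :
    ∃ C : ℝ, ∀ᵐ x : ℝ ∂volume, ‖Q x‖ ≤ C / (1 + |x| ^ 2) := by
  refine ⟨0, ?_⟩
  filter_upwards [ae_eq_zero_of_solvesProfileEquation hQ heq] with x hx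
  rw [hx, norm_zero, zero_div]
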